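/- **Setting.** For each $n\ge 1$ let $\nu_n$ be a probability measure on $\mathbb{R}^n$ that is invariant under all linear isometries and satisfies $\nu_n(\{0\})=0$. Assume that there are a deterministic sequence $(a_n)_{n\ge1}$ of nonzero reals and constants $d_1,d_2,\alpha>0$, $\rho_0\in(0,1)$ such that for every $n\ge 1$ and $\rho\in(0,\rho_0)$ $$\nu_n\left(\left\{x:\left|\frac{\|x\|^2}{a_n}-1\right|\ge\rho\right\}\right)\le d_1e^{-nd_2\rho^\alpha}.$$ Let $b_1^{(n)},\dots,b_{n-g}^{(n)}$ be independent random vectors of $\mathbb{R}^n$ with common law $\nu_n$ (a random basis of codimension $g$), and let $\widehat b_1^{(n)},\dots,\widehat b_{n-g}^{(n)}$ be their (unnormalized) Gram–Schmidt orthogonalization. For $g+2\le n$ put $$r_j^{(n)}=\frac{\|\widehat b_{n-j+1}^{(n)}\|^2}{\|\widehat b_{n-j}^{(n)}\|^2}\quad(g+1\le j\le n-1),\qquad \mathcal M_n^g=\min_{g+1\le j\le n-1}r_j^{(n)},\qquad \mathcal I_n^g=\min\{j\in\{g+1,\dots,n-1\}: r_j^{(n)}=\mathcal M_n^g\}.$$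 Let $(\eta_i)_{i\ge1}$ be independent random variables, $\eta_i$ having the gamma distribution with shape parameter $i/2$ and scale $1$, and put $\mathcal R_j=\eta_j/\eta_{j+1}$ for $j\ge1$ and $\mathcal M^k=\inf\{\mathcal R_j: j\ge k+1\}$ for integers $k\ge0$. **Theorem.** (i) For each fixed integer $k\ge0$, $\mathcal M_n^k$ converges in distribution to $\mathcal M^k$ as $n\to\infty$. (ii) Let $g:\mathbb N\to\mathbb N$ satisfy $g(n)\le n-2$ for all sufficiently large $n$ and $g(n)\to\infty$. Then $\mathcal M_n^{g(n)}\to1$ in probability as $n\to\infty$. (iii) For each fixed integer $k\ge0$, there is almost surely a unique index $\mathcal I^k\ge k+1$ such that $\mathcal R_{\mathcal I^k}=\mathcal M^k$, and $\mathcal I_n^k$ converges in distribution to $\mathcal I^k$ as $n\to\infty$. -/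

import Mathlib

open MeasureTheory ProbabilityTheory Filter
open scoped Topology

namespace RandomBasis

/-- A simple spherical model in `ℝⁿ`: a probability law invariant under all linear isometries,
without an atom at the origin. -/
structure IsSimpleSpherical {n : ℕ} (ν : Measure (EuclideanSpace ℝ (Fin n))) : Prop where
  isProbabilityMeasure : IsProbabilityMeasure ν
  map_isometry : ∀ U : EuclideanSpace ℝ (Fin n) ≃ₗᵢ[ℝ] EuclideanSpace ℝ (Fin n), ν.map U = ν
  zero : ν {0} = 0

/-- A spherical model: a simple spherical model in every dimension `n ≥ 1`. -/
def IsSpherical (ν : ∀ n : ℕ, Measure (EuclideanSpace ℝ (Fin n))) : Prop :=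
  ∀ n, 1 ≤ n → IsSimpleSpherical (ν n)

/-- Concentration of the squared radius: there are a deterministic sequence `a` and constants
`d₁, d₂, α > 0`, `ρ₀ ∈ (0, 1)` such that
`νₙ (| ‖x‖² / aₙ - 1 | ≥ ρ) ≤ d₁ exp (- n d₂ ρ ^ α)` for all `n ≥ 1` and `ρ ∈ (0, ρ₀)`. -/
def RadialConcentration (ν : ∀ n : ℕ, Measure (EuclideanSpace ℝ (Fin n))) : Prop :=
  ∃ (a : ℕ → ℝ) (d₁ d₂ α ρ₀ : ℝ),
    (∀ n, 1 ≤ n → a n ≠ 0) ∧ 0 < d₁ ∧ 0 < d₂ ∧ 0 < α ∧ 0 < ρ₀ ∧ ρ₀ < 1 ∧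
    ∀ n : ℕ, 1 ≤ n → ∀ ρ : ℝ, 0 < ρ → ρ < ρ₀ →
      (ν n).real {x | ρ ≤ |‖x‖ ^ 2 / a n - 1|} ≤ d₁ * Real.exp (-((n : ℝ) * d₂ * ρ ^ α))

/-- `b` is a system of `p` independent random vectors of `ℝⁿ` with common law `ν`. -/
structure IsRandomBasis {n p : ℕ} {Ω : Type*} [MeasurableSpace Ω] (P : Measure Ω)
    (ν : Measure (EuclideanSpace ℝ (Fin n)))
    (b : Fin p → Ω → EuclideanSpace ℝ (Fin n)) : Prop where
  hasLaw : ∀ i, HasLaw (b i) ν P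
  indep : iIndepFun b P

/-- The squared norm of the `i`-th Gram-Schmidt vector (unnormalized, `i` counted from `0`). -/
noncomputable def gsNormSq {n p : ℕ} (b : Fin p → EuclideanSpace ℝ (Fin n)) (i : Fin p) : ℝ :=
  ‖InnerProductSpace.gramSchmidt ℝ b i‖ ^ 2

/-- The ratio of the squared norms of two consecutive Gram-Schmidt vectors. Since indices are
counted from `0` here, this is `‖b̂_{i+2}‖² / ‖b̂_{i+1}‖²` when vectors are numbered `1, …, p`. -/
noncomputable def localRatio {n p : ℕ} (b : Fin p → EuclideanSpace ℝ (Fin n))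
    (i : Fin (p - 1)) : ℝ :=
  gsNormSq b ⟨i + 1, by omega⟩ / gsNormSq b ⟨i, by omega⟩

/-- The reduction level: the minimum of the `p - 1` consecutive ratios (meaningful for `p ≥ 2`). -/
noncomputable def reductionLevel {n p : ℕ} (b : Fin p → EuclideanSpace ℝ (Fin n)) : ℝ :=
  ⨅ i : Fin (p - 1), localRatio b i

/-- The index of worst local reduction of a system in `ℝⁿ`: with vectors numbered `1, …, p`, the
smallest `j` such that `‖b̂_{n-j+1}‖² / ‖b̂_{n-j}‖²` equals the reduction level. The ratio
`localRatio b i` has `n - j = i + 1`. -/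
noncomputable def worstIndex {n p : ℕ} (b : Fin p → EuclideanSpace ℝ (Fin n)) : ℕ :=
  sInf {j : ℕ | ∃ i : Fin (p - 1), j + ((i : ℕ) + 1) = n ∧ localRatio b i = reductionLevel b}

/-- `η₁, η₂, …` are independent and `ηᵢ` has the gamma law of shape `i / 2` and scale `1`.
The value `η 0` is not used. -/
structure IsGammaSequence {Ω : Type*} [MeasurableSpace Ω] (P : Measure Ω)
    (η : ℕ → Ω → ℝ) : Prop where
  hasLaw : ∀ i : ℕ, 1 ≤ i → HasLaw (η i) (gammaMeasure ((i : ℝ) / 2) 1) P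
  indep : iIndepFun (fun i : ℕ => η (i + 1)) P

/-- The limit process `R_j = η_j / η_{j+1}`, `j ≥ 1`. -/
noncomputable def limitRatio {Ω : Type*} (η : ℕ → Ω → ℝ) (j : ℕ) (ω : Ω) : ℝ :=
  η j ω / η (j + 1) ω

/-- `M^k = inf {R_j : j ≥ k + 1}`. -/
noncomputable def limitLevel {Ω : Type*} (η : ℕ → Ω → ℝ) (k : ℕ) (ω : Ω) : ℝ :=
  ⨅ j : {j : ℕ // k + 1 ≤ j}, limitRatio η j ω

/-- The index `I^k`: the (smallest, and almost surely the only) `j ≥ k + 1` with `R_j = M^k`. -/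
noncomputable def limitIndex {Ω : Type*} (η : ℕ → Ω → ℝ) (k : ℕ) (ω : Ω) : ℕ :=
  sInf {j : ℕ | k + 1 ≤ j ∧ limitRatio η j ω = limitLevel η k ω}

end RandomBasis

/-!
Giving a standard Gaussian vector the length of an independent vector of law `ν n` produces the
law `ν n`, by rotation invariance. This couples the random basis with a Gaussian one. Gram–Schmidt
orthogonalization is homogeneous in each vector, so the local ratios of the two bases differ only
by ratios of squared lengths, which by concentration all lie within a factor `κ n → 1` of each
other. The halved squared Gram–Schmidt norms of the Gaussian basis are independent gamma variables
with shapes `n / 2, (n - 1) / 2, …`, so its local ratios are distributed exactly as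
`R_{n-1}, R_{n-2}, …`. Finally `R_j → 1` almost surely, while infinitely many `R_j` are below `1`
and no two coincide. The minimum of the `R_j` is thus attained once and separated from the other
values by a factor `> 1`, so neither it nor its location is affected in the limit by factors
tending to `1`.
-/

namespace RandomBasis

section Gamma

variable {a r : ℝ}

lemma ae_gammaMeasure_pos (a r : ℝ) : ∀ᵐ x ∂gammaMeasure a r, 0 < x := by
  rw [ae_iff]
  simp only [not_lt]
  change gammaMeasure a r (Set.Iic 0) = 0
  rw [gammaMeasure, withDensity_apply _ measurableSet_Iic, setLIntegral_congr Iio_ae_eq_Iic.symm]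
  exact lintegral_gammaPDF_of_nonpos le_rfl

instance nullSingletonClass_gammaMeasure (a r : ℝ) :
    NullSingletonClass (gammaMeasure a r) :=
  ⟨fun _ => withDensity_absolutelyContinuous _ _ Real.volume_singleton⟩

lemma integral_gammaMeasure {E : Type*} [NormedAddCommGroup E] [NormedSpace ℝ E]
    (ha : 0 < a) (hr : 0 < r) (f : ℝ → E) :
    ∫ x, f x ∂gammaMeasure a r =
      ∫ x in Set.Ioi 0, (r ^ a / Real.Gamma a * x ^ (a - 1) * Real.exp (-(r * x))) • f x := by
  have hdensity : gammaMeasure a r =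
      volume.withDensity fun x => ENNReal.ofReal (gammaPDFReal a r x) := rfl
  rw [hdensity, integral_withDensity_eq_integral_toReal_smul
    (measurable_gammaPDFReal a r).ennreal_ofReal (by simp)]
  simp_rw [ENNReal.toReal_ofReal (gammaPDFReal_nonneg ha hr _)]
  rw [← integral_Ici_eq_integral_Ioi, ← integral_indicator measurableSet_Ici]
  congr 1 with x
  by_cases hx : 0 ≤ x
  · simp only [gammaPDFReal, hx, if_true, Set.indicator_of_mem (Set.mem_Ici.2 hx)]
  · simp [gammaPDFReal, hx]

lemma integral_pow_gammaMeasure (ha : 0 < a) (hr : 0 < r) (k : ℕ) :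
    ∫ x, x ^ k ∂gammaMeasure a r = Real.Gamma (a + k) / (r ^ k * Real.Gamma a) := by
  have hk : 0 < a + k := by positivity
  have := Real.Gamma_pos_of_pos ha
  calc ∫ x, x ^ k ∂gammaMeasure a r
      = ∫ x in Set.Ioi 0,
          r ^ a / Real.Gamma a * (x ^ (a + k - 1) * Real.exp (-(r * x))) := by
        rw [integral_gammaMeasure ha hr]
        refine setIntegral_congr_fun measurableSet_Ioi fun x (hx : 0 < x) => ?_
        rw [show a + k - 1 = (a - 1) + k by ring, Real.rpow_add hx, Real.rpow_natCast, smul_eq_mul]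
        ring
    _ = r ^ a / Real.Gamma a * ((1 / r) ^ (a + k) * Real.Gamma (a + k)) := by
        rw [integral_const_mul, Real.integral_rpow_mul_exp_neg_mul_Ioi hk hr]
    _ = Real.Gamma (a + k) / (r ^ k * Real.Gamma a) := by
        rw [one_div, Real.inv_rpow hr.le, Real.rpow_add hr, Real.rpow_natCast]
        have := Real.rpow_pos_of_pos hr a
        field_simp

lemma integrable_pow_gammaMeasure (ha : 0 < a) (hr : 0 < r) (k : ℕ) :
    Integrable (fun x => x ^ k) (gammaMeasure a r) := by
  refine Integrable.of_integral_ne_zero ?_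
  have := Real.Gamma_pos_of_pos ha
  have : 0 < Real.Gamma (a + k) := Real.Gamma_pos_of_pos (by positivity)
  rw [integral_pow_gammaMeasure ha hr]
  positivity

lemma integral_pow_succ_gammaMeasure (ha : 0 < a) (hr : 0 < r) (k : ℕ) :
    ∫ x, x ^ (k + 1) ∂gammaMeasure a r = (a + k) / r * ∫ x, x ^ k ∂gammaMeasure a r := by
  have hk : a + k ≠ 0 := by positivity
  rw [integral_pow_gammaMeasure ha hr, integral_pow_gammaMeasure ha hr, Nat.cast_succ,
    ← add_assoc, Real.Gamma_add_one hk, pow_succ]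
  field_simp

lemma integrable_sub_pow_gammaMeasure (ha : 0 < a) (hr : 0 < r) (c : ℝ) (k : ℕ) :
    Integrable (fun x => (x - c) ^ k) (gammaMeasure a r) := by
  simp only [sub_eq_add_neg, add_pow]
  exact integrable_finsetSum _ fun i _ =>
    ((integrable_pow_gammaMeasure ha hr i).mul_const _).mul_const _

lemma integral_fourth_central_gammaMeasure (ha : 0 < a) (hr : 0 < r) :
    ∫ x, (x - a / r) ^ 4 ∂gammaMeasure a r = (3 * a ^ 2 + 6 * a) / r ^ 4 := by
  have := isProbabilityMeasure_gammaMeasure ha hr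
  have hpow_zero : ∫ x : ℝ, x ^ 0 ∂gammaMeasure a r = 1 := by simp
  simp only [sub_eq_add_neg, add_pow]
  rw [integral_finsetSum _ fun i _ =>
    ((integrable_pow_gammaMeasure ha hr i).mul_const _).mul_const _]
  simp only [integral_mul_const, Finset.sum_range_succ, Finset.sum_range_zero,
    integral_pow_succ_gammaMeasure ha hr, hpow_zero, Nat.choose]
  push_cast
  field_simp
  ring

lemma gammaMeasure_real_le_abs_div_sub_one_le (ha : 1 / 2 ≤ a) (hr : 0 < r) {δ : ℝ} (hδ : 0 < δ) :
    (gammaMeasure a r).real {x | δ ≤ |r * x / a - 1|} ≤ 15 / (δ ^ 4 * a ^ 2) := by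
  have ha0 : 0 < a := by linarith
  have := isProbabilityMeasure_gammaMeasure ha0 hr
  have hsub : {x : ℝ | δ ≤ |r * x / a - 1|} ⊆ {x | (δ * (a / r)) ^ 4 ≤ (x - a / r) ^ 4} := by
    intro x (hx : δ ≤ |r * x / a - 1|)
    calc (δ * (a / r)) ^ 4 ≤ (|r * x / a - 1| * (a / r)) ^ 4 := by gcongr
      _ = (x - a / r) ^ 4 := by
        rw [mul_pow, Even.pow_abs (by decide), ← mul_pow]
        congr 1
        field_simp
  have hmarkov := mul_meas_ge_le_integral_of_nonneg (ae_of_all _ fun x => by positivity)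
    (integrable_sub_pow_gammaMeasure ha0 hr (a / r) 4) ((δ * (a / r)) ^ 4)
  rw [integral_fourth_central_gammaMeasure ha0 hr, mul_comm, ← le_div_iff₀ (by positivity)]
    at hmarkov
  calc _ ≤ _ := measureReal_mono hsub
    _ ≤ _ := hmarkov
    _ = (3 * a ^ 2 + 6 * a) / (δ ^ 4 * a ^ 4) := by field_simp
    _ ≤ 15 * a ^ 2 / (δ ^ 4 * a ^ 4) := by gcongr; nlinarith
    _ = 15 / (δ ^ 4 * a ^ 2) := by field_simp

lemma mgf_gammaMeasure {t : ℝ} (ha : 0 < a) (hr : 0 < r) (ht : t < r) :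
    mgf id (gammaMeasure a r) t = (r / (r - t)) ^ a := by
  have hrt : 0 < r - t := sub_pos.2 ht
  have := Real.Gamma_pos_of_pos ha
  calc mgf id (gammaMeasure a r) t
      = ∫ x in Set.Ioi 0,
          r ^ a / Real.Gamma a * (x ^ (a - 1) * Real.exp (-((r - t) * x))) := by
        rw [mgf, integral_gammaMeasure ha hr]
        refine setIntegral_congr_fun measurableSet_Ioi fun x _ => ?_
        rw [show -((r - t) * x) = -(r * x) + t * x by ring, Real.exp_add, smul_eq_mul, id]
        ring
    _ = r ^ a / Real.Gamma a * ((1 / (r - t)) ^ a * Real.Gamma a) := by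
        rw [integral_const_mul, Real.integral_rpow_mul_exp_neg_mul_Ioi ha hrt]
    _ = (r / (r - t)) ^ a := by
        rw [div_eq_mul_one_div r, Real.mul_rpow hr.le (by positivity)]
        field_simp

lemma mgf_gammaMeasure_of_le {t : ℝ} (ha : 0 < a) (hr : 0 < r) (ht : r ≤ t) :
    mgf id (gammaMeasure a r) t = 0 := by
  have := Real.Gamma_pos_of_pos ha
  have := Real.rpow_pos_of_pos hr a
  rw [mgf, integral_gammaMeasure ha hr]
  refine integral_undef fun h => not_integrableOn_Ioi_rpow (a - 1) ?_
  refine Integrable.mono' (h.mul_const (Real.Gamma a / r ^ a)) (by fun_prop) ?_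
  refine (ae_restrict_iff' measurableSet_Ioi).2 (ae_of_all _ fun x (hx : 0 < x) => ?_)
  have hpow := Real.rpow_pos_of_pos hx (a - 1)
  calc ‖x ^ (a - 1)‖ = x ^ (a - 1) := Real.norm_of_nonneg hpow.le
    _ ≤ x ^ (a - 1) * Real.exp (-(r * x) + t * x) :=
        le_mul_of_one_le_right hpow.le (Real.one_le_exp (by nlinarith))
    _ = _ := by
        rw [Real.exp_add, smul_eq_mul, id]
        field_simp

lemma zero_mem_interior_integrableExpSet_gammaMeasure (ha : 0 < a) (hr : 0 < r) :
    0 ∈ interior (integrableExpSet id (gammaMeasure a r)) := by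
  have := isProbabilityMeasure_gammaMeasure ha hr
  refine mem_interior.2 ⟨Set.Iio r, fun t (ht : t < r) => ?_, isOpen_Iio, hr⟩
  have : 0 < r - t := sub_pos.2 ht
  rw [integrableExpSet, Set.mem_ofPred_eq, ← mgf_pos_iff, mgf_gammaMeasure ha hr ht]
  positivity

end Gamma

lemma ext_of_mgf_id_eq {μ ν : Measure ℝ} [IsProbabilityMeasure μ] [IsProbabilityMeasure ν]
    (h : mgf id μ = mgf id ν) (h0 : 0 ∈ interior (integrableExpSet id μ)) : μ = ν := by
  refine Measure.ext_of_charFun ?_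
  ext t
  rw [← complexMGF_id_mul_I, ← complexMGF_id_mul_I]
  exact eqOn_complexMGF_of_mgf h (by simpa using h0)

lemma eq_gammaMeasure_of_mgf_id_eq {a r : ℝ} (ha : 0 < a) (hr : 0 < r) {μ : Measure ℝ}
    [IsProbabilityMeasure μ] (h : mgf id μ = mgf id (gammaMeasure a r)) : μ = gammaMeasure a r :=
  have := isProbabilityMeasure_gammaMeasure ha hr
  (ext_of_mgf_id_eq h.symm (zero_mem_interior_integrableExpSet_gammaMeasure ha hr)).symm

section Gaussian

lemma mgf_sq_gaussianReal (t : ℝ) :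
    mgf (fun x => x ^ 2 / 2) (gaussianReal 0 1) t = √(1 / (1 - t)) := by
  have hintegrand (x : ℝ) : gaussianPDFReal 0 1 x • Real.exp (t * (x ^ 2 / 2)) =
      (√(2 * Real.pi))⁻¹ * Real.exp (-((1 - t) / 2) * x ^ 2) := by
    rw [gaussianPDFReal, smul_eq_mul, mul_assoc, ← Real.exp_add]
    simp only [NNReal.coe_one, mul_one, sub_zero]
    congr 2
    ring
  rw [mgf, integral_gaussianReal_eq_integral_smul one_ne_zero]
  simp_rw [hintegrand]
  rw [integral_const_mul, integral_gaussian, ← Real.sqrt_inv, ← Real.sqrt_mul (by positivity)]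
  congr 1
  have := Real.pi_pos
  rcases eq_or_ne (1 - t) 0 with h0 | h0
  · simp [h0]
  · field_simp

variable {E : Type*} [NormedAddCommGroup E] [InnerProductSpace ℝ E] [FiniteDimensional ℝ E]
  [MeasurableSpace E] [BorelSpace E]

variable (E) in
lemma mgf_norm_sq_stdGaussian (t : ℝ) :
    mgf (fun x => ‖x‖ ^ 2 / 2) (stdGaussian E) t = √(1 / (1 - t)) ^ Module.finrank ℝ E := by
  have hexp (x : Fin (Module.finrank ℝ E) → ℝ) :
      Real.exp (t * (‖∑ i, x i • stdOrthonormalBasis ℝ E i‖ ^ 2 / 2)) =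
        ∏ i, Real.exp (t * (x i ^ 2 / 2)) := by
    rw [← Real.exp_sum, ← Finset.mul_sum, ← Finset.sum_div,
      ← (stdOrthonormalBasis ℝ E).sum_sq_norm_inner_right]
    simp [inner_sum, inner_smul_right, OrthonormalBasis.inner_eq_ite]
  rw [stdGaussian, mgf, integral_map (Measurable.aemeasurable (by fun_prop)) (by fun_prop)]
  simp_rw [hexp]
  rw [integral_fintype_prod_eq_prod (f := fun _ x => Real.exp (t * (x ^ 2 / 2)))]
  simp only [← mgf_sq_gaussianReal t, mgf, Finset.prod_const, Finset.card_univ, Fintype.card_fin]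

variable (E) in
lemma map_norm_sq_stdGaussian (hE : 0 < Module.finrank ℝ E) :
    (stdGaussian E).map (fun x => ‖x‖ ^ 2 / 2) = gammaMeasure (Module.finrank ℝ E / 2) 1 := by
  have hdim : 0 < (Module.finrank ℝ E : ℝ) / 2 := by positivity
  have : IsProbabilityMeasure ((stdGaussian E).map fun x => ‖x‖ ^ 2 / 2) :=
    Measure.isProbabilityMeasure_map (by fun_prop)
  refine eq_gammaMeasure_of_mgf_id_eq hdim one_pos ?_
  ext t
  rw [mgf_id_map (by fun_prop), mgf_norm_sq_stdGaussian]
  rcases lt_or_ge t 1 with ht | ht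
  · have : 0 < 1 - t := by linarith
    rw [mgf_gammaMeasure hdim one_pos ht, Real.sqrt_eq_rpow, ← Real.rpow_natCast,
      ← Real.rpow_mul (by positivity)]
    congr 1
    ring
  · rw [mgf_gammaMeasure_of_le hdim one_pos ht, Real.sqrt_eq_zero_of_nonpos, zero_pow hE.ne']
    exact one_div_nonpos.2 (by linarith)

lemma map_orthogonalProjection_stdGaussian (K : Submodule ℝ E) :
    (stdGaussian E).map K.orthogonalProjectionOnto = stdGaussian K := by
  have : IsProbabilityMeasure ((stdGaussian E).map K.orthogonalProjectionOnto) :=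
    Measure.isProbabilityMeasure_map (by fun_prop)
  refine Measure.ext_of_charFun ?_
  ext t
  have hE := charFun_stdGaussian (t : E)
  rw [charFun_apply] at hE
  rw [charFun_stdGaussian, charFun_apply, integral_map (by fun_prop) (by fun_prop),
    Submodule.coe_norm, ← hE]
  simp_rw [Submodule.inner_orthogonalProjectionOnto_eq_of_mem_right]

lemma map_norm_sq_orthogonalProjection_stdGaussian (K : Submodule ℝ E)
    (hK : 0 < Module.finrank ℝ K) :
    (stdGaussian E).map (fun x => ‖K.orthogonalProjectionOnto x‖ ^ 2 / 2) =
      gammaMeasure (Module.finrank ℝ K / 2) 1 := by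
  rw [← map_norm_sq_stdGaussian K hK, ← map_orthogonalProjection_stdGaussian K,
    Measure.map_map (by fun_prop) (by fun_prop)]
  rfl

variable (E) in
lemma stdGaussian_real_le_abs_norm_sq_div_sub_one_le (hE : 0 < Module.finrank ℝ E) {δ : ℝ}
    (hδ : 0 < δ) :
    (stdGaussian E).real {x | δ ≤ |‖x‖ ^ 2 / Module.finrank ℝ E - 1|} ≤
      60 / (δ ^ 4 * (Module.finrank ℝ E : ℝ) ^ 2) := by
  have hdim : 1 / 2 ≤ (Module.finrank ℝ E : ℝ) / 2 := by
    gcongr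
    exact_mod_cast hE
  have htail := gammaMeasure_real_le_abs_div_sub_one_le hdim one_pos hδ
  rw [← map_norm_sq_stdGaussian E hE,
    map_measureReal_apply (by fun_prop) (measurableSet_le (by fun_prop) (by fun_prop))] at htail
  convert htail using 1
  · congr with x
    simp only [Set.mem_ofPred_eq]
    congr! 3
    field_simp
  · field_simp
    norm_num

variable (E) in
lemma ae_stdGaussian_ne_zero (hE : 0 < Module.finrank ℝ E) :
    ∀ᵐ x ∂stdGaussian E, x ≠ 0 := by
  have hpos := ae_gammaMeasure_pos (Module.finrank ℝ E / 2) 1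
  rw [← map_norm_sq_stdGaussian E hE] at hpos
  filter_upwards [ae_of_ae_map (by fun_prop) hpos] with x hx h0
  simp [h0] at hx

end Gaussian

section GramSchmidt

lemma gramSchmidt_eq_starProjection_orthogonal {ι E : Type*} [LinearOrder ι]
    [LocallyFiniteOrderBot ι] [WellFoundedLT ι] [NormedAddCommGroup E] [InnerProductSpace ℝ E]
    [FiniteDimensional ℝ E] (b : ι → E) (i : ι) :
    InnerProductSpace.gramSchmidt ℝ b i =
      (Submodule.span ℝ (b '' Set.Iio i))ᗮ.starProjection (b i) := by
  set V := Submodule.span ℝ (b '' Set.Iio i) with hV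
  have horth : InnerProductSpace.gramSchmidt ℝ b i ∈ Vᗮ := by
    refine Submodule.le_orthogonal_iff_le_orthogonal.1 (Submodule.span_le.2 ?_)
      (Submodule.mem_span_singleton_self _)
    rintro _ ⟨j, hj, rfl⟩
    exact Submodule.mem_orthogonal_singleton_iff_inner_right.2
      (InnerProductSpace.gramSchmidt_inv_triangular ℝ b hj)
  have hsub : b i - InnerProductSpace.gramSchmidt ℝ b i ∈ V := by
    rw [InnerProductSpace.gramSchmidt_def, sub_sub_cancel, hV,
      ← InnerProductSpace.span_gramSchmidt_Iio]
    refine Submodule.sum_mem _ fun j hj => ?_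
    rw [Submodule.starProjection_singleton]
    exact Submodule.smul_mem _ _
      (Submodule.subset_span (Set.mem_image_of_mem _ (Finset.mem_Iio.1 hj)))
  exact (Submodule.eq_starProjection_of_mem_orthogonal horth
    (Submodule.le_orthogonal_orthogonal V hsub)).symm

lemma span_image_smul_eq {ι 𝕜 E : Type*} [DivisionRing 𝕜] [AddCommGroup E] [Module 𝕜 E]
    (b : ι → E) {c : ι → 𝕜} (hc : ∀ i, c i ≠ 0) (s : Set ι) :
    Submodule.span 𝕜 ((fun i => c i • b i) '' s) = Submodule.span 𝕜 (b '' s) := by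
  refine le_antisymm (Submodule.span_le.2 ?_) (Submodule.span_le.2 ?_)
  · rintro _ ⟨j, hj, rfl⟩
    exact Submodule.smul_mem _ _ (Submodule.subset_span ⟨j, hj, rfl⟩)
  · rintro _ ⟨j, hj, rfl⟩
    rw [← inv_smul_smul₀ (hc j) (b j)]
    exact Submodule.smul_mem _ _ (Submodule.subset_span ⟨j, hj, rfl⟩)

variable {n p : ℕ}

lemma gsNormSq_eq (b : Fin p → EuclideanSpace ℝ (Fin n)) (i : Fin p) :
    gsNormSq b i =
      ‖(Submodule.span ℝ (b '' Set.Iio i))ᗮ.orthogonalProjectionOnto (b i)‖ ^ 2 := by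
  rw [gsNormSq, gramSchmidt_eq_starProjection_orthogonal]
  rfl

lemma gsNormSq_smul (b : Fin p → EuclideanSpace ℝ (Fin n)) {c : Fin p → ℝ} (hc : ∀ i, c i ≠ 0)
    (i : Fin p) : gsNormSq (fun j => c j • b j) i = c i ^ 2 * gsNormSq b i := by
  rw [gsNormSq_eq, gsNormSq_eq, span_image_smul_eq b hc, map_smul, norm_smul, mul_pow,
    Real.norm_eq_abs, sq_abs]

lemma gsNormSq_castSucc (b : Fin (p + 1) → EuclideanSpace ℝ (Fin n)) (i : Fin p) :
    gsNormSq b i.castSucc = gsNormSq (Fin.init b) i := by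
  have himage : b '' Set.Iio i.castSucc = Fin.init b '' Set.Iio i := by
    change _ = (b ∘ Fin.castSucc) '' Set.Iio i
    rw [Set.image_comp, Fin.image_castSucc_Iio]
  rw [gsNormSq_eq, gsNormSq_eq, himage]
  rfl

lemma gsNormSq_snoc_last (b : Fin p → EuclideanSpace ℝ (Fin n)) (x : EuclideanSpace ℝ (Fin n)) :
    gsNormSq (Fin.snoc b x : Fin (p + 1) → EuclideanSpace ℝ (Fin n)) (Fin.last p) =
      ‖(Submodule.span ℝ (Set.range b))ᗮ.orthogonalProjectionOnto x‖ ^ 2 := by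
  have himage : (Fin.snoc b x : Fin (p + 1) → EuclideanSpace ℝ (Fin n)) '' Set.Iio (Fin.last p) =
      Set.range b := by
    have hIio : Set.Iio (Fin.last p) = Set.range Fin.castSucc := by
      ext j
      simp [Fin.range_castSucc, Fin.lt_def]
    rw [hIio, ← Set.range_comp]
    congr 1 with i
    simp
  rw [gsNormSq_eq, himage, Fin.snoc_last]

lemma measurable_gramSchmidt (i : Fin p) :
    Measurable fun b : Fin p → EuclideanSpace ℝ (Fin n) =>
      InnerProductSpace.gramSchmidt ℝ b i := by
  induction i using WellFoundedLT.induction with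
  | ind i ih =>
    simp_rw +singlePass [InnerProductSpace.gramSchmidt_def]
    simp only [Submodule.starProjection_singleton]
    refine (measurable_pi_apply i).sub (Finset.measurable_sum _ fun j hj => ?_)
    have hj := ih j (Finset.mem_Iio.1 hj)
    exact Measurable.smul ((hj.inner (measurable_pi_apply i)).div (hj.norm.pow_const 2)) hj

@[fun_prop]
lemma measurable_gsNormSq (i : Fin p) :
    Measurable fun b : Fin p → EuclideanSpace ℝ (Fin n) => gsNormSq b i :=
  (measurable_gramSchmidt i).norm.pow_const 2

@[fun_prop]
lemma measurable_localRatio :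
    Measurable (localRatio : (Fin p → EuclideanSpace ℝ (Fin n)) → Fin (p - 1) → ℝ) :=
  measurable_pi_lambda _ fun _ => (measurable_gsNormSq _).div (measurable_gsNormSq _)

lemma finrank_orthogonal_span_range (b : Fin p → EuclideanSpace ℝ (Fin n))
    (hb : ∀ i, gsNormSq b i ≠ 0) :
    Module.finrank ℝ (Submodule.span ℝ (Set.range b))ᗮ = n - p := by
  have hli : LinearIndependent ℝ (InnerProductSpace.gramSchmidt ℝ b) :=
    linearIndependent_of_ne_zero_of_inner_eq_zero (𝕜 := ℝ)
      (fun i h0 => hb i (by simp [gsNormSq, h0]))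
      fun i j hij => InnerProductSpace.gramSchmidt_orthogonal ℝ b hij
  have hspan := finrank_span_eq_card hli
  rw [InnerProductSpace.span_gramSchmidt, Fintype.card_fin] at hspan
  have hadd := (Submodule.span ℝ (Set.range b)).finrank_add_finrank_orthogonal
  rw [finrank_euclideanSpace_fin] at hadd
  omega

end GramSchmidt

section GaussianGramSchmidt

lemma measurable_snoc {α : Type*} [MeasurableSpace α] (p : ℕ) :
    Measurable fun z : (Fin p → α) × α => (Fin.snoc z.1 z.2 : Fin (p + 1) → α) := by
  refine measurable_pi_lambda _ (Fin.lastCases ?_ fun j => ?_)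
  · simpa only [Fin.snoc_last] using measurable_snd
  · simp only [Fin.snoc_castSucc]
    fun_prop

lemma measurePreserving_pi_snoc {α β : Type*} [MeasurableSpace α] [MeasurableSpace β] {p : ℕ}
    {μ : Fin (p + 1) → Measure α} {ν : Fin (p + 1) → Measure β} [∀ i, SigmaFinite (μ i)]
    [∀ i, SigmaFinite (ν i)] {f : (Fin p → α) → Fin p → β} {g : (Fin p → α) → α → β}
    (hf : MeasurePreserving f (Measure.pi fun i => μ i.castSucc)
      (Measure.pi fun i => ν i.castSucc))
    (hgm : Measurable (Function.uncurry g))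
    (hg : ∀ᵐ x ∂Measure.pi fun i => μ i.castSucc,
      (μ (Fin.last p)).map (g x) = ν (Fin.last p)) :
    MeasurePreserving
      (fun x : Fin (p + 1) → α =>
        (Fin.snoc (f (Fin.init x)) (g (Fin.init x) (x (Fin.last p))) : Fin (p + 1) → β))
      (Measure.pi μ) (Measure.pi ν) := by
  have hμ := measurePreserving_piFinSuccAbove μ (Fin.last p)
  have hν := (measurePreserving_piFinSuccAbove ν (Fin.last p)).symm
  simp only [Fin.succAbove_last] at hμ hν
  convert hν.comp ((Measure.measurePreserving_swap.comp (hf.skew_product hgm hg)).comp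
    (Measure.measurePreserving_swap.comp hμ)) using 1
  ext x i
  refine Fin.lastCases ?_ (fun j => ?_) i <;>
    simp [MeasurableEquiv.piFinSuccAbove]

variable {n p : ℕ}

lemma ae_map_gsNormSq_last_stdGaussian (hp : p < n)
    (hpos : ∀ᵐ b ∂Measure.pi fun _ : Fin p => stdGaussian (EuclideanSpace ℝ (Fin n)),
      ∀ i, gsNormSq b i ≠ 0) :
    ∀ᵐ b ∂Measure.pi fun _ : Fin p => stdGaussian (EuclideanSpace ℝ (Fin n)),
      (stdGaussian (EuclideanSpace ℝ (Fin n))).map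
        (fun x => gsNormSq (Fin.snoc b x : Fin (p + 1) → EuclideanSpace ℝ (Fin n))
          (Fin.last p) / 2) = gammaMeasure ((n - p : ℕ) / 2) 1 := by
  filter_upwards [hpos] with b hb
  have hfinrank := finrank_orthogonal_span_range b hb
  simp_rw [gsNormSq_snoc_last]
  rw [map_norm_sq_orthogonalProjection_stdGaussian _ (by omega), hfinrank]

lemma measurePreserving_gsNormSq_stdGaussian (hp : p ≤ n) :
    MeasurePreserving
      (fun (b : Fin p → EuclideanSpace ℝ (Fin n)) i => gsNormSq b i / 2)
      (Measure.pi fun _ => stdGaussian (EuclideanSpace ℝ (Fin n)))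
      (Measure.pi fun i : Fin p => gammaMeasure ((n - i : ℕ) / 2) 1) := by
  induction p with
  | zero =>
    refine ⟨by fun_prop, ?_⟩
    rw [Measure.pi_of_empty, Measure.pi_of_empty, Measure.map_dirac' (by fun_prop)]
    congr 1
    exact Subsingleton.elim _ _
  | succ p ih =>
    have hprob (i : Fin (p + 1)) :
        IsProbabilityMeasure (gammaMeasure (((n - i : ℕ) : ℝ) / 2) 1) := by
      have : 0 < n - i := by omega
      exact isProbabilityMeasure_gammaMeasure (by positivity) one_pos
    have hinit := ih (by omega)
    have hpos : ∀ᵐ b ∂Measure.pi fun _ : Fin p => stdGaussian (EuclideanSpace ℝ (Fin n)),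
        ∀ i, gsNormSq b i ≠ 0 := by
      refine ae_all_iff.2 fun i => ?_
      have (j : Fin p) : IsProbabilityMeasure (gammaMeasure (((n - j : ℕ) : ℝ) / 2) 1) :=
        hprob j.castSucc
      have heval := (Measure.quasiMeasurePreserving_eval _ i).comp hinit.quasiMeasurePreserving
      filter_upwards [heval.ae (ae_gammaMeasure_pos _ _)] with b hb h0
      simp [h0] at hb
    convert measurePreserving_pi_snoc
      (μ := fun _ : Fin (p + 1) => stdGaussian (EuclideanSpace ℝ (Fin n)))
      (ν := fun i : Fin (p + 1) => gammaMeasure (((n - i : ℕ) : ℝ) / 2) 1) hinit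
      (g := fun b x => gsNormSq (Fin.snoc b x : Fin (p + 1) → EuclideanSpace ℝ (Fin n))
        (Fin.last p) / 2) ?_ (ae_map_gsNormSq_last_stdGaussian (by omega) hpos) using 1
    · ext b i
      refine Fin.lastCases ?_ (fun j => ?_) i
      · simp
      · simp [gsNormSq_castSucc]
    · exact ((measurable_gsNormSq (Fin.last p)).comp (measurable_snoc p)).div_const 2

end GaussianGramSchmidt

section Rotation

variable {E : Type*} [NormedAddCommGroup E] [InnerProductSpace ℝ E]

/-- The vector with the norm of `z.1` and the direction of `z.2` (`0` if `z.2 = 0`). It replaces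
the length of a Gaussian vector by one of prescribed law. -/
noncomputable def transferNorm (z : E × E) : E :=
  ‖z.1‖ • NormedSpace.normalize z.2

lemma transferNorm_eq_smul (z : E × E) : transferNorm z = (‖z.1‖ / ‖z.2‖) • z.2 := by
  rw [transferNorm, NormedSpace.normalize, smul_smul, div_eq_mul_inv]

variable [MeasurableSpace E]

/-- Rotation invariance: linear isometries of the space onto itself preserve `μ`. It is separated
from `IsSimpleSpherical` since it applies in any space, in particular to Gaussian measures. -/
def IsRotationInvariant (μ : Measure E) : Prop :=
  ∀ U : E ≃ₗᵢ[ℝ] E, μ.map U = μ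

variable [BorelSpace E]

@[fun_prop]
lemma measurable_normalize : Measurable (NormedSpace.normalize : E → E) := by
  unfold NormedSpace.normalize
  fun_prop

lemma IsRotationInvariant.map_normalize {μ : Measure E} (hμ : IsRotationInvariant μ) :
    IsRotationInvariant (μ.map NormedSpace.normalize) := by
  intro U
  have hU : Measurable U := U.continuous.measurable
  conv_rhs => rw [← hμ U]
  rw [Measure.map_map hU (by fun_prop), Measure.map_map (by fun_prop) hU]
  congr 1 with x
  simp [NormedSpace.normalize]

variable [FiniteDimensional ℝ E]

variable (E) in
lemma isRotationInvariant_stdGaussian : IsRotationInvariant (stdGaussian E) :=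
  fun U => stdGaussian_map U

lemma IsRotationInvariant.charFun_eq_of_norm_eq {μ : Measure E}
    (hμ : IsRotationInvariant μ) {s t : E} (h : ‖s‖ = ‖t‖) : charFun μ s = charFun μ t := by
  obtain ⟨U, rfl⟩ : ∃ U : E ≃ₗᵢ[ℝ] E, U s = t :=
    ⟨(ℝ ∙ (s - t))ᗮ.reflection, Submodule.reflection_sub h⟩
  conv_rhs => rw [← hμ U]
  rw [charFun_apply, charFun_apply, integral_map (by fun_prop) (by fun_prop)]
  simp

/- Both `‖x‖ • t` and `‖t‖ • x` have norm `‖x‖ ‖t‖`, so invariance of `σ` allows exchanging them;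
this turns the characteristic function of `‖x‖ • u` into an average of that of `ν`. -/
lemma IsRotationInvariant.map_norm_smul_prod {ν σ : Measure E}
    [IsProbabilityMeasure ν] [IsProbabilityMeasure σ] (hν : IsRotationInvariant ν)
    (hσ : IsRotationInvariant σ) (hunit : ∀ᵐ u ∂σ, ‖u‖ = 1) :
    (ν.prod σ).map (fun z => ‖z.1‖ • z.2) = ν := by
  have hint {g : E × E → ℝ} (hg : Measurable g) :
      Integrable (fun z => Complex.exp (g z * Complex.I)) (ν.prod σ) :=
    .of_bound (by fun_prop) 1 (ae_of_all _ fun z => by rw [Complex.norm_exp_ofReal_mul_I])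
  refine Measure.ext_of_charFun ?_
  ext t
  calc charFun ((ν.prod σ).map fun z => ‖z.1‖ • z.2) t
      = ∫ x, charFun σ (‖x‖ • t) ∂ν := by
        rw [charFun_apply, integral_map (by fun_prop) (by fun_prop),
          integral_prod _ (hint (by fun_prop))]
        simp_rw [charFun_apply, inner_smul_left, inner_smul_right]
        rfl
    _ = ∫ x, charFun σ (‖t‖ • x) ∂ν := by
        refine integral_congr_ae (ae_of_all _ fun x => hσ.charFun_eq_of_norm_eq ?_)
        simp [norm_smul, mul_comm]
    _ = ∫ x, ∫ u, Complex.exp (inner ℝ x (‖t‖ • u) * Complex.I) ∂σ ∂ν := by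
        simp_rw [charFun_apply, inner_smul_right, real_inner_comm]
    _ = ∫ u, charFun ν (‖t‖ • u) ∂σ := integral_integral_swap (hint (by fun_prop))
    _ = ∫ _, charFun ν t ∂σ := by
        refine integral_congr_ae (hunit.mono fun u hu => hν.charFun_eq_of_norm_eq ?_)
        simp [norm_smul, hu]
    _ = charFun ν t := by simp

@[fun_prop]
lemma measurable_transferNorm : Measurable (transferNorm (E := E)) := by
  unfold transferNorm
  fun_prop

lemma IsRotationInvariant.map_transferNorm {ν γ : Measure E} [IsProbabilityMeasure ν]
    [IsProbabilityMeasure γ] (hν : IsRotationInvariant ν) (hγ : IsRotationInvariant γ)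
    (hγ0 : ∀ᵐ y ∂γ, y ≠ 0) : (ν.prod γ).map transferNorm = ν := by
  have := Measure.isProbabilityMeasure_map (μ := γ) measurable_normalize.aemeasurable
  have hunit : ∀ᵐ u ∂γ.map NormedSpace.normalize, ‖u‖ = 1 := by
    rw [ae_map_iff (by fun_prop) (measurableSet_eq_fun (by fun_prop) (by fun_prop))]
    exact hγ0.mono fun y hy => NormedSpace.norm_normalize_eq_one_iff.2 hy
  conv_rhs => rw [← hν.map_norm_smul_prod hγ.map_normalize hunit, ← Measure.map_id (μ := ν),
    Measure.map_prod_map _ _ measurable_id measurable_normalize,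
    Measure.map_map (by fun_prop) (by fun_prop)]
  rfl

end Rotation

section MulClose

/-- Multiplicative closeness: `x` and `y` agree up to a factor in `[κ⁻¹, κ]`; meaningful for
positive numbers. It compares the local ratios of coupled systems. -/
def MulClose (κ x y : ℝ) : Prop :=
  y ≤ κ * x ∧ x ≤ κ * y

variable {κ κ' x x' y y' : ℝ}

lemma MulClose.div (h : MulClose κ x y) (h' : MulClose κ' x' y') (hx : 0 ≤ x) (hy : 0 ≤ y)
    (hx' : 0 < x') (hy' : 0 < y') : MulClose (κ * κ') (x / x') (y / y') := by
  constructor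
  · rw [← mul_div_assoc, div_le_div_iff₀ hy' hx']
    calc y * x' ≤ κ * x * (κ' * y') := mul_le_mul h.1 h'.2 hx'.le (hy.trans h.1)
      _ = κ * κ' * x * y' := by ring
  · rw [← mul_div_assoc, div_le_div_iff₀ hx' hy']
    calc x * y' ≤ κ * y * (κ' * x') := mul_le_mul h.2 h'.1 hy'.le (hx.trans h.2)
      _ = κ * κ' * y * x' := by ring

lemma MulClose.mul_right (h : MulClose κ x y) {c : ℝ} (hc : 0 ≤ c) :
    MulClose κ (x * c) (y * c) := by
  simp only [MulClose, ← mul_assoc]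
  exact ⟨mul_le_mul_of_nonneg_right h.1 hc, mul_le_mul_of_nonneg_right h.2 hc⟩

lemma mulClose_one_of_abs_sub_one_le (hκ : 1 ≤ κ) (h : |x - 1| ≤ 1 - κ⁻¹) : MulClose κ x 1 := by
  have hκ0 : 0 < κ := by linarith
  have hκinv : κ * κ⁻¹ = 1 := mul_inv_cancel₀ hκ0.ne'
  obtain ⟨hl, hu⟩ := abs_le.1 h
  constructor <;> nlinarith [sq_nonneg (κ - 1)]

variable {ι : Type*} [Finite ι] {R S : ι → ℝ}

lemma MulClose.iInf (hκ : 0 ≤ κ) (h : ∀ i, MulClose κ (R i) (S i)) :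
    MulClose κ (⨅ i, R i) (⨅ i, S i) := by
  rw [MulClose, Real.mul_iInf_of_nonneg hκ, Real.mul_iInf_of_nonneg hκ]
  exact ⟨ciInf_mono (Set.finite_range S).bddBelow fun i => (h i).1,
    ciInf_mono (Set.finite_range R).bddBelow fun i => (h i).2⟩

lemma localRatio_nonneg {n p : ℕ} (b : Fin p → EuclideanSpace ℝ (Fin n)) (i : Fin (p - 1)) :
    0 ≤ localRatio b i := by
  unfold localRatio gsNormSq
  positivity

lemma mulClose_localRatio_smul {n p : ℕ} (b : Fin p → EuclideanSpace ℝ (Fin n)) {c : Fin p → ℝ}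
    {s : ℝ} (hs : 0 < s) (hc : ∀ j, c j ≠ 0) (hκ : ∀ j, MulClose κ (s * c j ^ 2) 1)
    (i : Fin (p - 1)) :
    MulClose (κ * κ) (localRatio (fun j => c j • b j) i) (localRatio b i) := by
  have hpos (j : Fin p) : 0 < s * c j ^ 2 := by
    have := hc j
    positivity
  convert ((hκ ⟨i + 1, by omega⟩).div (hκ ⟨i, by omega⟩) (hpos _).le zero_le_one (hpos _)
    one_pos).mul_right (localRatio_nonneg b i) using 1
  · rw [localRatio, gsNormSq_smul b hc, gsNormSq_smul b hc, localRatio,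
      mul_div_mul_left _ _ hs.ne', mul_div_mul_comm]
  · ring

lemma mulClose_localRatio_transferNorm {n p : ℕ} {u v : ℝ} (hκ : 1 ≤ κ)
    {x y : Fin p → EuclideanSpace ℝ (Fin n)} (hx : ∀ j, |‖x j‖ ^ 2 / u - 1| < 1 - κ⁻¹)
    (hy : ∀ j, |‖y j‖ ^ 2 / v - 1| < 1 - κ⁻¹) (i : Fin (p - 1)) :
    MulClose (κ ^ 4) (localRatio (fun j => transferNorm (x j, y j)) i) (localRatio y i) := by
  have hpos {t : ℝ} (ht : |t - 1| < 1 - κ⁻¹) : 0 < t := by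
    have : 0 < κ⁻¹ := by positivity
    linarith [(abs_lt.1 ht).1]
  have hdenom {r w : ℝ} (h : 0 < r ^ 2 / w) : 0 < w := by
    by_contra! hw
    exact h.not_ge (div_nonpos_of_nonneg_of_nonpos (sq_nonneg r) hw)
  have hu : 0 < u := hdenom (hpos (hx ⟨i, by omega⟩))
  have hv : 0 < v := hdenom (hpos (hy ⟨i, by omega⟩))
  have hx0 (j : Fin p) : ‖x j‖ ≠ 0 := fun h => by simpa [h] using hpos (hx j)
  have hy0 (j : Fin p) : ‖y j‖ ≠ 0 := fun h => by simpa [h] using hpos (hy j)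
  have hscale (j : Fin p) : MulClose (κ * κ) (v / u * (‖x j‖ / ‖y j‖) ^ 2) 1 := by
    convert (mulClose_one_of_abs_sub_one_le hκ (hx j).le).div
      (mulClose_one_of_abs_sub_one_le hκ (hy j).le) (hpos (hx j)).le zero_le_one (hpos (hy j))
      one_pos using 1
    · have := hy0 j
      field_simp
    · rw [div_one]
  simp only [transferNorm_eq_smul]
  convert mulClose_localRatio_smul y (div_pos hv hu) (fun j => div_ne_zero (hx0 j) (hy0 j))
    hscale i using 1
  ring

end MulClose

section Coupling

lemma exists_tendsto_atTop_eventually {p : ℕ → ℕ → Prop} (h : ∀ k, ∀ᶠ n in atTop, p k n) :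
    ∃ φ : ℕ → ℕ, Tendsto φ atTop atTop ∧ ∀ᶠ n in atTop, p (φ n) n := by
  obtain ⟨ψ, hψ, hp⟩ := extraction_forall_of_eventually
    (P := fun k N => ∀ n ≥ N, p k n) fun k => eventually_forall_ge_atTop.2 (h k)
  refine ⟨fun n => Nat.findGreatest (fun k => ψ k ≤ n) n, ?_, ?_⟩
  · refine tendsto_atTop.2 fun k => ?_
    filter_upwards [eventually_ge_atTop (ψ k)] with n hn
    exact Nat.le_findGreatest (hψ.le_apply.trans hn) hn
  · filter_upwards [eventually_ge_atTop (ψ 0)] with n hn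
    exact hp _ n (Nat.findGreatest_spec (P := fun k => ψ k ≤ n) n.zero_le hn)

lemma tendsto_measure_zero_of_ae_eventually_notMem {α : Type*} [MeasurableSpace α]
    {μ : Measure α} [IsFiniteMeasure μ] {s : ℕ → Set α} (hs : ∀ n, NullMeasurableSet (s n) μ)
    (h : ∀ᵐ x ∂μ, ∀ᶠ n in atTop, x ∉ s n) : Tendsto (fun n => μ (s n)) atTop (𝓝 0) := by
  have hlim := tendsto_lintegral_of_dominated_convergence' (μ := μ) (f := 0)
    (F := fun n => (s n).indicator 1) 1
    (fun n => (aemeasurable_indicator_const_iff 1).2 (hs n))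
    (fun n => ae_of_all _ (Set.indicator_le_self' fun _ _ => zero_le))
    (by simp) (h.mono fun x hx => tendsto_const_nhds.congr' ?_)
  · simpa [lintegral_indicator_one₀ (hs _)] using hlim
  · filter_upwards [hx] with n hn
    simp [hn]

variable {E : Type*} [PseudoMetricSpace E] [MeasurableSpace E] [BorelSpace E]

lemma levyProkhorovDist_fst_snd_le {Q : Measure (E × E)} [IsProbabilityMeasure Q] {δ : ℝ}
    (hδ : 0 ≤ δ) (hQ : Q {z | δ ≤ dist z.1 z.2} ≤ ENNReal.ofReal δ) :
    levyProkhorovDist Q.fst Q.snd ≤ δ := by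
  refine levyProkhorovDist_le_of_forall_le _ _ hδ fun ε B hε hB => ?_
  rw [Measure.fst_apply hB, Measure.snd_apply Metric.isOpen_thickening.measurableSet]
  have hsub : Prod.fst ⁻¹' B ⊆
      Prod.snd ⁻¹' Metric.thickening ε B ∪ {z : E × E | δ ≤ dist z.1 z.2} := by
    intro z hz
    by_cases h : δ ≤ dist z.1 z.2
    · exact Or.inr h
    · refine Or.inl (Metric.mem_thickening_iff.2 ⟨z.1, hz, ?_⟩)
      rw [dist_comm]
      exact (not_le.1 h).trans hε
  calc Q (Prod.fst ⁻¹' B)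
      ≤ Q (Prod.snd ⁻¹' Metric.thickening ε B) + Q {z | δ ≤ dist z.1 z.2} :=
        (measure_mono hsub).trans (measure_union_le _ _)
    _ ≤ Q (Prod.snd ⁻¹' Metric.thickening ε B) + ENNReal.ofReal ε := by
        gcongr
        exact hQ.trans (ENNReal.ofReal_le_ofReal hε.le)

variable [SecondCountableTopology E]

lemma tendsto_probabilityMeasure_of_coupling {μ ν : ℕ → ProbabilityMeasure E}
    {ρ : ProbabilityMeasure E} (hν : Tendsto ν atTop (𝓝 ρ)) {Q : ℕ → Measure (E × E)}
    (hfst : ∀ᶠ n in atTop, (Q n).fst = μ n) (hsnd : ∀ᶠ n in atTop, (Q n).snd = ν n)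
    (hQ : ∀ ε : ℝ, 0 < ε → Tendsto (fun n => Q n {z | ε ≤ dist z.1 z.2}) atTop (𝓝 0)) :
    Tendsto μ atTop (𝓝 ρ) := by
  have hind := (LevyProkhorov.probabilityMeasureHomeomorph (Ω := E)).isInducing
  refine hind.tendsto_nhds_iff.2 (tendsto_of_tendsto_of_dist (hind.tendsto_nhds_iff.1 hν) ?_)
  rw [Metric.tendsto_nhds]
  intro ε hε
  filter_upwards [hfst, hsnd, (hQ (ε / 2) (half_pos hε)).eventually_le_const
    (ENNReal.ofReal_pos.2 (half_pos hε))] with n hμn hνn hn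
  have : IsProbabilityMeasure (Q n).fst := hμn ▸ inferInstance
  have : IsProbabilityMeasure (Q n) :=
    (Measure.isProbabilityMeasure_map_iff measurable_fst.aemeasurable).1 this
  rw [Real.dist_0_eq_abs, abs_of_nonneg dist_nonneg, dist_comm]
  calc dist _ _ = levyProkhorovDist (Q n).fst (Q n).snd := by rw [hμn, hνn]; rfl
    _ ≤ ε / 2 := levyProkhorovDist_fst_snd_le (half_pos hε).le hn
    _ < ε := half_lt_self hε

variable {Ω : ℕ → Type*} [∀ n, MeasurableSpace (Ω n)] {P : ∀ n, Measure (Ω n)}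
  [∀ n, IsProbabilityMeasure (P n)] {Ω' : Type*} [MeasurableSpace Ω'] {P' : Measure Ω'}
  [IsProbabilityMeasure P'] {S : ℕ → Type*} [∀ n, MeasurableSpace (S n)]

/- `C n` consists of the pairs regarded as close, and `G n` of the points at which `f n` changes
by less than `ε` between close points. -/
theorem tendstoInDistribution_comp_of_coupling {X : ∀ n, Ω n → S n} {T : ∀ n, Ω' → S n}
    (hX : ∀ n, AEMeasurable (X n) (P n)) (hT : ∀ n, AEMeasurable (T n) P')
    {Q : ∀ n, Measure (S n × S n)} (hfst : ∀ᶠ n in atTop, (Q n).fst = (P n).map (X n))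
    (hsnd : ∀ᶠ n in atTop, (Q n).snd = P'.map (T n)) {C : ∀ n, Set (S n × S n)}
    (hC : Tendsto (fun n => Q n (C n)ᶜ) atTop (𝓝 0)) {f : ∀ n, S n → E}
    (hf : ∀ n, Measurable (f n)) {Z : Ω' → E}
    (hTZ : ∀ᵐ ω ∂P', Tendsto (fun n => f n (T n ω)) atTop (𝓝 (Z ω)))
    (hG : ∀ ε : ℝ, 0 < ε → ∃ G : ∀ n, Set (S n), (∀ n, MeasurableSet (G n)) ∧
      (∀ᵐ ω ∂P', ∀ᶠ n in atTop, T n ω ∈ G n) ∧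
      ∀ᶠ n in atTop, ∀ z ∈ C n, z.2 ∈ G n → dist (f n z.1) (f n z.2) < ε) :
    TendstoInDistribution (fun n ω => f n (X n ω)) atTop Z P P' := by
  have hfX (n) : AEMeasurable (fun ω => f n (X n ω)) (P n) := (hf n).comp_aemeasurable (hX n)
  have hfT (n) : AEMeasurable (fun ω => f n (T n ω)) P' := (hf n).comp_aemeasurable (hT n)
  have hff (n) : Measurable (Prod.map (f n) (f n)) := (hf n).prodMap (hf n)
  have hZ : AEMeasurable Z P' := aemeasurable_of_tendsto_metrizable_ae _ hfT hTZ
  refine ⟨hfX, hZ, tendsto_probabilityMeasure_of_coupling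
    (tendstoInDistribution_of_ae_tendsto hfT hZ hTZ).tendsto
    (Q := fun n => (Q n).map (Prod.map (f n) (f n))) ?_ ?_ fun ε hε => ?_⟩
  · filter_upwards [hfst] with n hn
    calc ((Q n).map (Prod.map (f n) (f n))).fst = (Q n).map (f n ∘ Prod.fst) :=
          Measure.fst_map_prodMk ((hf n).comp measurable_snd)
      _ = ((Q n).fst).map (f n) := (Measure.map_map (hf n) measurable_fst).symm
      _ = ((P n).map (X n)).map (f n) := by rw [hn]
      _ = (P n).map (f n ∘ X n) :=
          AEMeasurable.map_map_of_aemeasurable (hf n).aemeasurable (hX n)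
  · filter_upwards [hsnd] with n hn
    calc ((Q n).map (Prod.map (f n) (f n))).snd = (Q n).map (f n ∘ Prod.snd) :=
          Measure.snd_map_prodMk ((hf n).comp measurable_fst)
      _ = ((Q n).snd).map (f n) := (Measure.map_map (hf n) measurable_snd).symm
      _ = (P'.map (T n)).map (f n) := by rw [hn]
      _ = P'.map (f n ∘ T n) :=
          AEMeasurable.map_map_of_aemeasurable (hf n).aemeasurable (hT n)
  · obtain ⟨G, hGm, hTG, hstab⟩ := hG ε hε
    have hGc : Tendsto (fun n => P' (T n ⁻¹' (G n)ᶜ)) atTop (𝓝 0) :=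
      tendsto_measure_zero_of_ae_eventually_notMem
        (fun n => (hT n).nullMeasurable (hGm n).compl) (by simpa using hTG)
    refine tendsto_of_tendsto_of_tendsto_of_le_of_le' tendsto_const_nhds
      (by simpa only [add_zero] using hC.add hGc) (.of_forall fun _ => zero_le) ?_
    filter_upwards [hsnd, hstab] with n hn hstab
    rw [Measure.map_apply (hff n) (measurableSet_le (by fun_prop) (by fun_prop)),
      ← Measure.map_apply_of_aemeasurable (hT n) (hGm n).compl, ← hn,
      Measure.snd_apply (hGm n).compl]
    refine (measure_mono fun z hz => ?_).trans (measure_union_le _ _)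
    by_contra hcon
    simp only [Set.mem_union, Set.mem_compl_iff, Set.mem_preimage, not_or, not_not] at hcon
    exact (hstab z hcon.1 hcon.2).not_ge hz

end Coupling

section GaussianCoupling

/-- The joint law of the local ratios of a Gaussian system of `p` vectors of `ℝⁿ` (second
component) and of the system obtained from it by giving the vectors independent lengths
distributed as under `ν` (first component). -/
noncomputable def gaussianCoupling {n : ℕ} (ν : Measure (EuclideanSpace ℝ (Fin n))) (p : ℕ) :
    Measure ((Fin (p - 1) → ℝ) × (Fin (p - 1) → ℝ)) :=
  (Measure.pi fun _ : Fin p => ν.prod (stdGaussian _)).map fun w =>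
    (localRatio fun j => transferNorm (w j), localRatio fun j => (w j).2)

variable {n p : ℕ} {ν : Measure (EuclideanSpace ℝ (Fin n))} [IsProbabilityMeasure ν]

lemma fst_gaussianCoupling (hn : 0 < n) (hν : IsRotationInvariant ν) :
    (gaussianCoupling ν p).fst = (Measure.pi fun _ : Fin p => ν).map localRatio := by
  have hγ := ae_stdGaussian_ne_zero (EuclideanSpace ℝ (Fin n)) (by simpa using hn)
  have hpi := Measure.pi_map_pi (μ := fun _ : Fin p => ν.prod (stdGaussian _))
    (f := fun _ => transferNorm) fun _ => by fun_prop
  simp only [hν.map_transferNorm (isRotationInvariant_stdGaussian _) hγ] at hpi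
  rw [gaussianCoupling, Measure.fst_map_prodMk (by fun_prop), ← hpi,
    Measure.map_map (by fun_prop) (by fun_prop)]
  rfl

lemma snd_gaussianCoupling :
    (gaussianCoupling ν p).snd =
      (Measure.pi fun _ : Fin p => stdGaussian (EuclideanSpace ℝ (Fin n))).map localRatio := by
  have hpi := Measure.pi_map_pi
    (μ := fun _ : Fin p => ν.prod (stdGaussian (EuclideanSpace ℝ (Fin n))))
    (f := fun _ => Prod.snd) fun _ => by fun_prop
  simp only [measurePreserving_snd.map_eq] at hpi
  rw [gaussianCoupling, Measure.snd_map_prodMk (by fun_prop), ← hpi,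
    Measure.map_map (by fun_prop) (by fun_prop)]
  rfl

lemma measurableSet_forall_mulClose (κ : ℝ) (ι : Type*) [Countable ι] :
    MeasurableSet {z : (ι → ℝ) × (ι → ℝ) | ∀ i, MulClose κ (z.1 i) (z.2 i)} := by
  simp only [MulClose, Set.ofPred_forall]
  exact .iInter fun i =>
    (measurableSet_le (f := fun z : (ι → ℝ) × (ι → ℝ) => z.2 i) (g := fun z => κ * z.1 i)
      (by fun_prop) (by fun_prop)).inter
    (measurableSet_le (f := fun z : (ι → ℝ) × (ι → ℝ) => z.1 i) (g := fun z => κ * z.2 i)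
      (by fun_prop) (by fun_prop))

lemma gaussianCoupling_real_not_mulClose_le (hn : 0 < n) {κ : ℝ} (hκ : 1 < κ) (a : ℝ) :
    (gaussianCoupling ν p).real {z | ∀ i, MulClose (κ ^ 4) (z.1 i) (z.2 i)}ᶜ ≤
      p * (ν.real {x | 1 - κ⁻¹ ≤ |‖x‖ ^ 2 / a - 1|} + 60 / ((1 - κ⁻¹) ^ 4 * n ^ 2)) := by
  set δ := 1 - κ⁻¹
  set E := EuclideanSpace ℝ (Fin n)
  set μ : Measure (Fin p → E × E) := Measure.pi fun _ => ν.prod (stdGaussian E)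
  have hδ : 0 < δ := sub_pos.2 (inv_lt_one_of_one_lt₀ hκ)
  let A (j : Fin p) : Set (Fin p → E × E) := {w | δ ≤ |‖(w j).1‖ ^ 2 / a - 1|}
  let B (j : Fin p) : Set (Fin p → E × E) := {w | δ ≤ |‖(w j).2‖ ^ 2 / n - 1|}
  have hmeas (c : ℝ) : MeasurableSet {x : E | δ ≤ |‖x‖ ^ 2 / c - 1|} :=
    measurableSet_le (by fun_prop) (by fun_prop)
  have hA (j) : μ.real (A j) = ν.real {x | δ ≤ |‖x‖ ^ 2 / a - 1|} :=
    (measurePreserving_fst.comp (measurePreserving_eval _ j)).measureReal_preimage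
      (hmeas a).nullMeasurableSet
  have hB (j) : μ.real (B j) ≤ 60 / (δ ^ 4 * n ^ 2) := by
    have hgauss := stdGaussian_real_le_abs_norm_sq_div_sub_one_le E
      (by rwa [finrank_euclideanSpace_fin]) hδ
    rw [finrank_euclideanSpace_fin] at hgauss
    exact ((measurePreserving_snd.comp (measurePreserving_eval _ j)).measureReal_preimage
      (hmeas n).nullMeasurableSet).trans_le hgauss
  have hsub : (fun w : Fin p → E × E => (localRatio fun j => transferNorm (w j),
      localRatio fun j => (w j).2)) ⁻¹' {z | ∀ i, MulClose (κ ^ 4) (z.1 i) (z.2 i)}ᶜ ⊆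
        ⋃ j, A j ∪ B j := by
    refine fun w hw => by_contra fun hcon => hw fun i => ?_
    simp only [Set.mem_iUnion, Set.mem_union, not_exists, not_or] at hcon
    exact mulClose_localRatio_transferNorm hκ.le (fun j => not_le.1 (hcon j).1)
      (fun j => not_le.1 (hcon j).2) i
  rw [gaussianCoupling, map_measureReal_apply (by fun_prop)
    (measurableSet_forall_mulClose _ _).compl]
  calc _ ≤ ∑ j, μ.real (A j ∪ B j) :=
        (measureReal_mono hsub).trans (measureReal_iUnion_fintype_le _)
    _ ≤ ∑ _j : Fin p, (ν.real {x | δ ≤ |‖x‖ ^ 2 / a - 1|} + 60 / (δ ^ 4 * n ^ 2)) :=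
        Finset.sum_le_sum fun j _ =>
          (measureReal_union_le _ _).trans (add_le_add (hA j).le (hB j))
    _ = _ := by rw [Finset.sum_const, Finset.card_univ, Fintype.card_fin, nsmul_eq_mul]

end GaussianCoupling

section WeakRadialConcentration

/-- Concentration of the squared radius around `a n`, in the form which survives a union bound
over `n` independent vectors. -/
def WeakRadialConcentration (ν : ∀ n : ℕ, Measure (EuclideanSpace ℝ (Fin n))) : Prop :=
  ∃ a : ℕ → ℝ, ∀ δ > 0,
    Tendsto (fun n : ℕ => n * (ν n).real {x | δ ≤ |‖x‖ ^ 2 / a n - 1|}) atTop (𝓝 0)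

lemma RadialConcentration.weak {ν : ∀ n : ℕ, Measure (EuclideanSpace ℝ (Fin n))}
    (hν : ∀ᶠ n in atTop, IsProbabilityMeasure (ν n)) (h : RadialConcentration ν) :
    WeakRadialConcentration ν := by
  obtain ⟨a, d₁, d₂, α, ρ₀, -, -, hd₂, -, hρ₀, -, hconc⟩ := h
  refine ⟨a, fun δ hδ => ?_⟩
  obtain ⟨ρ, hρ, hρδ⟩ := exists_between (lt_min hδ hρ₀)
  have hrate : 0 < d₂ * ρ ^ α := mul_pos hd₂ (Real.rpow_pos_of_pos hρ α)
  have hlim := ((tendsto_rpow_mul_exp_neg_mul_atTop_nhds_zero 1 _ hrate).comp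
    tendsto_natCast_atTop_atTop).const_mul d₁
  rw [mul_zero] at hlim
  refine squeeze_zero' (.of_forall fun n => by positivity) ?_ hlim
  filter_upwards [eventually_ge_atTop 1, hν] with n hn hprob
  calc n * (ν n).real {x | δ ≤ |‖x‖ ^ 2 / a n - 1|}
      ≤ n * (ν n).real {x | ρ ≤ |‖x‖ ^ 2 / a n - 1|} :=
        mul_le_mul_of_nonneg_left (measureReal_mono fun x hx =>
          (hρδ.trans_le (min_le_left _ _)).le.trans hx) n.cast_nonneg
    _ ≤ n * (d₁ * Real.exp (-(n * d₂ * ρ ^ α))) :=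
        mul_le_mul_of_nonneg_left (hconc n hn ρ hρ (hρδ.trans_le (min_le_right _ _)))
          n.cast_nonneg
    _ = d₁ * ((n : ℝ) ^ (1 : ℝ) * Real.exp (-(d₂ * ρ ^ α) * n)) := by
        rw [Real.rpow_one, neg_mul, mul_assoc, mul_comm (n : ℝ) (d₂ * ρ ^ α),
          mul_left_comm]

variable {ν : ∀ n : ℕ, Measure (EuclideanSpace ℝ (Fin n))} {p : ℕ → ℕ}

lemma WeakRadialConcentration.tendsto_gaussianCoupling (h : WeakRadialConcentration ν)
    (hν : ∀ᶠ n in atTop, IsProbabilityMeasure (ν n)) (hp : ∀ n, p n ≤ n) {κ : ℝ} (hκ : 1 < κ) :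
    Tendsto (fun n => gaussianCoupling (ν n) (p n) {z | ∀ i, MulClose κ (z.1 i) (z.2 i)}ᶜ) atTop
      (𝓝 0) := by
  obtain ⟨a, ha⟩ := h
  obtain ⟨r, hr, rfl⟩ : ∃ r : ℝ, 1 < r ∧ r ^ 4 = κ :=
    ⟨κ ^ (4⁻¹ : ℝ), Real.one_lt_rpow hκ (by norm_num), by
      rw [← Real.rpow_natCast, ← Real.rpow_mul (by linarith)]; norm_num⟩
  set δ := 1 - r⁻¹
  have hδ : 0 < δ := sub_pos.2 (inv_lt_one_of_one_lt₀ hr)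
  have hlim := (ha δ hδ).add
    ((tendsto_inv_atTop_zero.comp (tendsto_natCast_atTop_atTop (R := ℝ))).const_mul (60 / δ ^ 4))
  rw [mul_zero, add_zero] at hlim
  have hlim' := ENNReal.tendsto_ofReal hlim
  rw [ENNReal.ofReal_zero] at hlim'
  refine tendsto_of_tendsto_of_tendsto_of_le_of_le' tendsto_const_nhds hlim'
    (.of_forall fun _ => zero_le) ?_
  filter_upwards [hν, eventually_gt_atTop 0] with n hprob hn
  have hpn : (p n : ℝ) ≤ n := by exact_mod_cast hp n
  have hn0 : (n : ℝ) ≠ 0 := by exact_mod_cast hn.ne'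
  have hfin : IsFiniteMeasure (gaussianCoupling (ν n) (p n)) := by
    unfold gaussianCoupling
    infer_instance
  rw [← ofReal_measureReal]
  refine ENNReal.ofReal_le_ofReal ?_
  calc _ ≤ p n * ((ν n).real {x | δ ≤ |‖x‖ ^ 2 / a n - 1|} + 60 / (δ ^ 4 * n ^ 2)) :=
        gaussianCoupling_real_not_mulClose_le hn hr (a n)
    _ ≤ n * ((ν n).real {x | δ ≤ |‖x‖ ^ 2 / a n - 1|} + 60 / (δ ^ 4 * n ^ 2)) := by gcongr
    _ = n * (ν n).real {x | δ ≤ |‖x‖ ^ 2 / a n - 1|} + 60 / δ ^ 4 * (n : ℝ)⁻¹ := by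
        field_simp

lemma WeakRadialConcentration.exists_tendsto_gaussianCoupling (h : WeakRadialConcentration ν)
    (hν : ∀ᶠ n in atTop, IsProbabilityMeasure (ν n)) (hp : ∀ n, p n ≤ n) :
    ∃ κ : ℕ → ℝ, (∀ n, 1 < κ n) ∧ Tendsto κ atTop (𝓝 1) ∧
      Tendsto (fun n => gaussianCoupling (ν n) (p n)
        {z | ∀ i, MulClose (κ n) (z.1 i) (z.2 i)}ᶜ) atTop (𝓝 0) := by
  obtain ⟨φ, hφ, hsmall⟩ := exists_tendsto_atTop_eventually fun k =>
    (h.tendsto_gaussianCoupling hν hp (κ := 1 + 1 / ((k : ℝ) + 1))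
      (lt_add_of_pos_right 1 (by positivity))).eventually_le_const
        (ENNReal.ofReal_pos.2 (Nat.one_div_pos_of_nat (α := ℝ) (n := k)))
  have hdiv := (tendsto_one_div_add_atTop_nhds_zero_nat (𝕜 := ℝ)).comp hφ
  refine ⟨fun n => 1 + 1 / ((φ n : ℝ) + 1), fun n => lt_add_of_pos_right 1 (by positivity),
    by simpa only [add_zero, Function.comp_def] using hdiv.const_add 1, ?_⟩
  have hdiv' := ENNReal.tendsto_ofReal hdiv
  rw [ENNReal.ofReal_zero] at hdiv'
  exact tendsto_of_tendsto_of_tendsto_of_le_of_le' tendsto_const_nhds hdiv'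
    (.of_forall fun _ => zero_le) hsmall

end WeakRadialConcentration

section LocalRatioLimit

variable {Ω' : Type*} {η : ℕ → Ω' → ℝ}

/-- The limit ratios `R_{n-1}, R_{n-2}, …`, in the order of the local ratios of a system of `p`
vectors of `ℝⁿ`. -/
noncomputable def limitVector (η : ℕ → Ω' → ℝ) (n p : ℕ) (ω : Ω') (i : Fin (p - 1)) : ℝ :=
  limitRatio η (n - 1 - i) ω

variable [MeasurableSpace Ω'] {P' : Measure Ω'}

lemma IsGammaSequence.aemeasurable_limitVector (hη : IsGammaSequence P' η) {n p : ℕ}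
    (hp : p ≤ n) : AEMeasurable (limitVector η n p) P' :=
  aemeasurable_pi_lambda _ fun i =>
    (hη.hasLaw _ (by omega)).aemeasurable.div (hη.hasLaw _ (by omega)).aemeasurable

lemma IsGammaSequence.map_localRatio_stdGaussian [IsProbabilityMeasure P']
    (hη : IsGammaSequence P' η) {n p : ℕ} (hp : p ≤ n) :
    (Measure.pi fun _ : Fin p => stdGaussian (EuclideanSpace ℝ (Fin n))).map localRatio =
      P'.map (limitVector η n p) := by
  have hgs := measurePreserving_gsNormSq_stdGaussian hp
  have hlaw (i : Fin p) : HasLaw (η (n - 1 - i + 1)) (gammaMeasure ((n - i : ℕ) / 2) 1) P' := by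
    have h := hη.hasLaw (n - i) (by omega)
    rwa [show n - (i : ℕ) = n - 1 - i + 1 by omega] at h ⊢
  have hpi := (hη.indep.precomp (g := fun i : Fin p => n - 1 - (i : ℕ)) fun i j hij =>
    Fin.ext (by simp only at hij; omega)).hasLaw_pi hlaw
  let D (y : Fin p → ℝ) (i : Fin (p - 1)) : ℝ := y ⟨i + 1, by omega⟩ / y ⟨i, by omega⟩
  have hD : Measurable D := by fun_prop
  have hratio : localRatio = D ∘ fun (b : Fin p → EuclideanSpace ℝ (Fin n)) i =>
      gsNormSq b i / 2 := by
    ext b i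
    exact (div_div_div_cancel_right₀ two_ne_zero _ _).symm
  have hvector : limitVector η n p = D ∘ fun ω (i : Fin p) => η (n - 1 - i + 1) ω := by
    ext ω i
    rw [limitVector, limitRatio]
    simp only [D, Function.comp_apply]
    rw [show n - 1 - ((i : ℕ) + 1) + 1 = n - 1 - i by omega]
  rw [hratio, hvector, ← Measure.map_map hD hgs.measurable, hgs.map_eq,
    ← AEMeasurable.map_map_of_aemeasurable hD.aemeasurable hpi.aemeasurable, hpi.map_eq]

section IsRandomBasis

variable {n p : ℕ} {Ω : Type*} [MeasurableSpace Ω] {P : Measure Ω}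
  {ν : Measure (EuclideanSpace ℝ (Fin n))} {b : Fin p → Ω → EuclideanSpace ℝ (Fin n)}

lemma IsRandomBasis.aemeasurable_localRatio (hb : IsRandomBasis P ν b) :
    AEMeasurable (fun ω => localRatio fun i => b i ω) P :=
  measurable_localRatio.comp_aemeasurable
    (aemeasurable_pi_lambda _ fun i => (hb.hasLaw i).aemeasurable)

lemma IsRandomBasis.map_localRatio [IsProbabilityMeasure P] (hb : IsRandomBasis P ν b) :
    P.map (fun ω => localRatio fun i => b i ω) =
      (Measure.pi fun _ : Fin p => ν).map localRatio := by
  have hpi := hb.indep.hasLaw_pi hb.hasLaw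
  rw [← hpi.map_eq, AEMeasurable.map_map_of_aemeasurable measurable_localRatio.aemeasurable
    hpi.aemeasurable]
  rfl

end IsRandomBasis

variable [IsProbabilityMeasure P'] {E : Type*} [MetricSpace E] [SecondCountableTopology E]
  [MeasurableSpace E] [BorelSpace E] {ν : ∀ n : ℕ, Measure (EuclideanSpace ℝ (Fin n))}
  {Ω : ℕ → Type*} [∀ n, MeasurableSpace (Ω n)] {P : ∀ n, Measure (Ω n)}
  [∀ n, IsProbabilityMeasure (P n)] {p : ℕ → ℕ}
  {b : ∀ n : ℕ, Fin (p n) → Ω n → EuclideanSpace ℝ (Fin n)}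

/- A random basis and the Gaussian one have the same local ratios in the limit, up to factors
`κ n → 1`, and the Gaussian local ratios are distributed as `limitVector`. -/
theorem tendstoInDistribution_comp_localRatio
    (hν : ∀ᶠ n in atTop, IsRotationInvariant (ν n)) (hconc : WeakRadialConcentration ν)
    (hη : IsGammaSequence P' η) (hp : ∀ n, p n ≤ n) (hp0 : ∀ᶠ n in atTop, 0 < p n)
    (hb : ∀ n, IsRandomBasis (P n) (ν n) (b n)) {f : ∀ n, (Fin (p n - 1) → ℝ) → E}
    (hf : ∀ n, Measurable (f n)) {Z : Ω' → E}
    (hZ : ∀ᵐ ω ∂P', Tendsto (fun n => f n (limitVector η n (p n) ω)) atTop (𝓝 (Z ω)))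
    (hG : ∀ κ : ℕ → ℝ, (∀ n, 1 < κ n) → Tendsto κ atTop (𝓝 1) → ∀ ε : ℝ, 0 < ε →
      ∃ G : ∀ n, Set (Fin (p n - 1) → ℝ), (∀ n, MeasurableSet (G n)) ∧
        (∀ᵐ ω ∂P', ∀ᶠ n in atTop, limitVector η n (p n) ω ∈ G n) ∧
        ∀ᶠ n in atTop, ∀ x, ∀ y ∈ G n, (∀ i, MulClose (κ n) (x i) (y i)) →
          dist (f n x) (f n y) < ε) :
    TendstoInDistribution (fun n ω => f n (localRatio fun i => b n i ω)) atTop Z P P' := by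
  have hprob : ∀ᶠ n in atTop, IsProbabilityMeasure (ν n) :=
    hp0.mono fun n hn => ((hb n).hasLaw ⟨0, hn⟩).isProbabilityMeasure_iff.1 inferInstance
  obtain ⟨κ, hκ, hκ1, hC⟩ := hconc.exists_tendsto_gaussianCoupling hprob hp
  refine tendstoInDistribution_comp_of_coupling (fun n => (hb n).aemeasurable_localRatio)
    (fun n => hη.aemeasurable_limitVector (hp n)) ?_ ?_ hC hf hZ fun ε hε => ?_
  · filter_upwards [hν, hprob, eventually_gt_atTop 0] with n hν _ hn
    rw [fst_gaussianCoupling hn hν, (hb n).map_localRatio]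
  · filter_upwards [hprob] with n _
    rw [snd_gaussianCoupling, hη.map_localRatio_stdGaussian (hp n)]
  · obtain ⟨G, hGm, hTG, hstab⟩ := hG κ hκ hκ1 ε hε
    exact ⟨G, hGm, hTG, hstab.mono fun n hn z hz hzG => hn z.1 z.2 hzG hz⟩

end LocalRatioLimit

section GapMin

variable {ι : Type*} {κ κ' : ℝ} {R S : ι → ℝ} {i₀ i : ι}

/-- `R` has a positive minimum at `i₀` with a multiplicative gap `κ` below the other entries. For
`κ > 1` the place of the minimum is then stable under `MulClose` perturbations. -/
def IsGapMin (κ : ℝ) (R : ι → ℝ) (i₀ : ι) : Prop :=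
  0 < R i₀ ∧ ∀ i ≠ i₀, κ * R i₀ ≤ R i

lemma IsGapMin.lt (h : IsGapMin κ R i₀) (hκ : 1 < κ) (hi : i ≠ i₀) : R i₀ < R i :=
  (lt_mul_of_one_lt_left h.1 hκ).trans_le (h.2 i hi)

lemma IsGapMin.iInf_eq (h : IsGapMin κ R i₀) (hκ : 1 < κ) : ⨅ i, R i = R i₀ :=
  IsLeast.csInf_eq ⟨⟨i₀, rfl⟩, Set.forall_mem_range.2 fun i => by
    obtain rfl | hi := eq_or_ne i i₀
    · rfl
    · exact (h.lt hκ hi).le⟩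

lemma IsGapMin.eq_iInf_iff (h : IsGapMin κ R i₀) (hκ : 1 < κ) : R i = ⨅ i, R i ↔ i = i₀ := by
  rw [h.iInf_eq hκ]
  exact ⟨fun he => by_contra fun hi => (h.lt hκ hi).ne' he, fun hi => congrArg R hi⟩

lemma IsGapMin.mono (h : IsGapMin κ R i₀) (hκ : κ' ≤ κ) : IsGapMin κ' R i₀ :=
  ⟨h.1, fun i hi => (mul_le_mul_of_nonneg_right hκ h.1.le).trans (h.2 i hi)⟩

lemma IsGapMin.comp_injective {ι' : Type*} {e : ι' → ι} (he : Function.Injective e) {j : ι'}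
    (h : IsGapMin κ R (e j)) : IsGapMin κ (R ∘ e) j :=
  ⟨h.1, fun i hi => h.2 (e i) (he.ne hi)⟩

lemma IsGapMin.of_mulClose (h : IsGapMin (κ ^ 3) R i₀) (hκ : 0 < κ)
    (hSR : ∀ i, MulClose κ (S i) (R i)) : IsGapMin κ S i₀ := by
  refine ⟨pos_of_mul_pos_right (h.1.trans_le (hSR i₀).1) hκ.le, fun i hi => ?_⟩
  refine le_of_mul_le_mul_left ?_ hκ
  calc κ * (κ * S i₀) ≤ κ * (κ * (κ * R i₀)) := by gcongr; exact (hSR i₀).2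
    _ = κ ^ 3 * R i₀ := by ring
    _ ≤ κ * S i := (h.2 i hi).trans (hSR i).1

lemma measurableSet_exists_isGapMin (κ : ℝ) (ι : Type*) [Countable ι] :
    MeasurableSet {R : ι → ℝ | ∃ i₀, IsGapMin κ R i₀} := by
  simp only [IsGapMin, Set.ofPred_exists, Set.ofPred_and, Set.ofPred_forall]
  exact .iUnion fun i₀ => (measurableSet_lt measurable_const (measurable_pi_apply i₀)).inter <|
    .iInter fun i => .iInter fun _ => measurableSet_le
      (by fun_prop : Measurable fun R : ι → ℝ => κ * R i₀) (measurable_pi_apply i)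

lemma exists_isGapMin {c : ℝ} (hpos : ∀ i, 0 < R i) (hinj : Function.Injective R)
    (hlim : Tendsto R cofinite (𝓝 c)) (hlt : ∃ i, R i < c) :
    ∃ i₀ κ, 1 < κ ∧ IsGapMin κ R i₀ := by
  obtain ⟨i₁, hi₁⟩ := hlt
  obtain ⟨m, hm, hmc⟩ := exists_between hi₁
  have hfin : {i | R i ≤ m}.Finite := by
    simpa only [not_lt] using eventually_cofinite.1 (hlim.eventually_const_lt hmc)
  obtain ⟨i₀, -, hmin⟩ := Set.exists_min_image _ R hfin ⟨i₁, hm.le⟩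
  have hlim₀ : Tendsto (fun κ => κ * R i₀) (𝓝[>] 1) (𝓝 (R i₀)) :=
    ((continuous_mul_const _).tendsto' 1 _ (one_mul _)).mono_left nhdsWithin_le_nhds
  have hnear : ∀ᶠ κ in 𝓝[>] (1 : ℝ), ∀ i ∈ {i | R i ≤ m}, i ≠ i₀ → κ * R i₀ < R i :=
    (eventually_all_finite hfin).2 fun i hi => eventually_imp_distrib_left.2 fun hne =>
      hlim₀.eventually_lt_const ((hmin i hi).lt_of_ne (hinj.ne hne.symm))
  have hfar : ∀ᶠ κ in 𝓝[>] (1 : ℝ), κ * R i₀ < m :=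
    hlim₀.eventually_lt_const ((hmin i₁ hm.le).trans_lt hm)
  obtain ⟨κ, hκ, hκnear, hκfar⟩ :=
    (eventually_mem_nhdsWithin.and (hnear.and hfar)).exists
  refine ⟨i₀, κ, hκ, hpos i₀, fun i hi => ?_⟩
  obtain him | him := le_or_gt (R i) m
  · exact (hκnear i him hi).le
  · exact (hκfar.trans him).le

end GapMin

section LimitSequence

lemma ae_ne_of_indepFun {Ω E : Type*} [MeasurableSpace Ω] {P : Measure Ω} [IsProbabilityMeasure P]
    [MeasurableSpace E] [MeasurableEq E] {X Y : Ω → E} (hX : AEMeasurable X P)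
    (hY : AEMeasurable Y P) (h : IndepFun X Y P) [NullSingletonClass (P.map Y)] :
    ∀ᵐ ω ∂P, X ω ≠ Y ω := by
  have := Measure.isProbabilityMeasure_map hY
  have hprod : ∀ᵐ z ∂(P.map X).prod (P.map Y), z.1 ≠ z.2 :=
    (Measure.ae_prod_iff_ae_ae (measurableSet_eq_fun measurable_fst measurable_snd).compl).2
      (ae_of_all _ fun x => (measure_eq_zero_iff_ae_notMem.1 (measure_singleton x)).mono
        fun _ hy => Ne.symm hy)
  rw [← (indepFun_iff_map_prod_eq_prod_map_map hX hY).1 h] at hprod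
  exact ae_of_ae_map (hX.prodMk hY) hprod

variable {Ω : Type*} {η : ℕ → Ω → ℝ} {ω : Ω}

lemma tendsto_limitRatio (h : Tendsto (fun j : ℕ => η j ω / (j / 2)) atTop (𝓝 1)) :
    Tendsto (fun j => limitRatio η j ω) atTop (𝓝 1) := by
  have hquot := (h.div (h.comp (tendsto_add_atTop_nat 1)) one_ne_zero).mul
    (tendsto_natCast_div_add_atTop (1 : ℝ))
  rw [div_one, mul_one] at hquot
  refine hquot.congr' ?_
  filter_upwards [eventually_gt_atTop 0] with j hj
  have : (0 : ℝ) < j := Nat.cast_pos.2 hj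
  simp only [limitRatio, Function.comp_apply, Pi.div_apply, Nat.cast_succ]
  field_simp

lemma exists_limitRatio_lt_one (hpos : ∀ j ≥ 1, 0 < η j ω)
    (h : Tendsto (fun j : ℕ => η j ω / (j / 2)) atTop (𝓝 1)) (k : ℕ) :
    ∃ j ≥ k, limitRatio η j ω < 1 := by
  have htop : Tendsto (fun j : ℕ => η j ω) atTop atTop := by
    have hhalf : Tendsto (fun j : ℕ => (j : ℝ) / 2) atTop atTop :=
      tendsto_natCast_atTop_atTop.atTop_div_const two_pos
    refine (h.pos_mul_atTop one_pos hhalf).congr' ?_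
    filter_upwards [hhalf.eventually_ne_atTop 0] with j hj
    exact div_mul_cancel₀ _ hj
  obtain ⟨j, hj, hrecord⟩ := high_scores htop (k + 1)
  obtain ⟨j, rfl⟩ := Nat.exists_eq_succ_of_ne_zero (by omega : j ≠ 0)
  exact ⟨j, by omega, (div_lt_one (hpos _ (by omega))).2 (hrecord j (by omega))⟩

variable [MeasurableSpace Ω] {P : Measure Ω}

lemma IsGammaSequence.ae_pos (hη : IsGammaSequence P η) : ∀ᵐ ω ∂P, ∀ j ≥ 1, 0 < η j ω := by
  refine ae_all_iff.2 fun j => eventually_imp_distrib_left.2 fun hj => ?_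
  have h := ae_gammaMeasure_pos ((j : ℝ) / 2) 1
  rw [← (hη.hasLaw j hj).map_eq] at h
  exact ae_of_ae_map (hη.hasLaw j hj).aemeasurable h

variable [IsProbabilityMeasure P]

lemma IsGammaSequence.ae_eventually_abs_div_sub_one_lt (hη : IsGammaSequence P η) {δ : ℝ}
    (hδ : 0 < δ) : ∀ᵐ ω ∂P, ∀ᶠ j : ℕ in atTop, |η j ω / (j / 2) - 1| < δ := by
  have htail (j : ℕ) (hj : 1 ≤ j) :
      P.real {ω | δ ≤ |η j ω / (j / 2) - 1|} ≤ 60 / δ ^ 4 * (1 / (j : ℝ) ^ 2) := by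
    have hj' : (1 : ℝ) ≤ j := Nat.one_le_cast.2 hj
    have h := gammaMeasure_real_le_abs_div_sub_one_le (a := (j : ℝ) / 2) (by linarith) one_pos hδ
    simp only [one_mul] at h
    rw [← (hη.hasLaw j hj).measureReal_eq (measurableSet_le measurable_const (by fun_prop))] at h
    exact h.trans_eq (by field_simp; norm_num)
  have hsum : Summable fun j : ℕ => P.real {ω | δ ≤ |η j ω / (j / 2) - 1|} :=
    ((Real.summable_one_div_nat_pow.2 one_lt_two).mul_left (60 / δ ^ 4)).of_norm_bounded_eventually
      (Nat.cofinite_eq_atTop ▸ (eventually_ge_atTop 1).mono fun j hj => by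
        rw [Real.norm_of_nonneg measureReal_nonneg]
        exact htail j hj)
  have hfinite : ∑' j : ℕ, P {ω | δ ≤ |η j ω / (j / 2) - 1|} ≠ ⊤ := by
    simpa only [ofReal_measureReal (measure_ne_top P _)] using hsum.tsum_ofReal_ne_top
  filter_upwards [ae_eventually_notMem hfinite] with ω hω
  simpa only [Set.mem_ofPred_eq, not_le] using hω

lemma IsGammaSequence.ae_tendsto_div (hη : IsGammaSequence P η) :
    ∀ᵐ ω ∂P, Tendsto (fun j : ℕ => η j ω / (j / 2)) atTop (𝓝 1) := by
  have h := ae_all_iff.2 fun m : ℕ =>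
    hη.ae_eventually_abs_div_sub_one_lt (Nat.one_div_pos_of_nat (α := ℝ) (n := m))
  filter_upwards [h] with ω hω
  refine Metric.tendsto_nhds.2 fun ε hε => ?_
  obtain ⟨m, hm⟩ := exists_nat_one_div_lt hε
  exact (hω m).mono fun j hj => hj.trans hm

lemma IsGammaSequence.ae_limitRatio_ne (hη : IsGammaSequence P η) {i j : ℕ} (hi : 1 ≤ i)
    (hij : i < j) : ∀ᵐ ω ∂P, limitRatio η i ω ≠ limitRatio η j ω := by
  obtain ⟨i, rfl⟩ := Nat.exists_eq_succ_of_ne_zero (by omega : i ≠ 0)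
  obtain ⟨j, rfl⟩ := Nat.exists_eq_succ_of_ne_zero (by omega : j ≠ 0)
  have hmeas (l : ℕ) : AEMeasurable (η (l + 1)) P := (hη.hasLaw (l + 1) (by omega)).aemeasurable
  have hindep : IndepFun (fun ω => η (i + 2) ω * limitRatio η (j + 1) ω) (η (i + 1)) P :=
    (hη.indep.indepFun_finset₀ {i + 1, j, j + 1} {i}
      (by rw [Finset.disjoint_singleton_right]; simp; omega) hmeas).comp
      (φ := fun v : ({i + 1, j, j + 1} : Finset ℕ) → ℝ =>
        v ⟨i + 1, by simp⟩ * (v ⟨j, by simp⟩ / v ⟨j + 1, by simp⟩))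
      (ψ := fun v : ({i} : Finset ℕ) → ℝ => v ⟨i, by simp⟩) (by fun_prop) (by fun_prop)
  have : NullSingletonClass (P.map (η (i + 1))) := by
    rw [(hη.hasLaw (i + 1) (by omega)).map_eq]
    infer_instance
  filter_upwards [hη.ae_pos, ae_ne_of_indepFun
    ((hmeas (i + 1)).mul ((hmeas j).div (hmeas (j + 1)))) (hmeas i) hindep] with ω hpos hne heq
  refine hne (Eq.trans (congrArg (η (i + 2) ω * ·) heq.symm) ?_)
  exact mul_div_cancel₀ _ (hpos (i + 2) (by omega)).ne'

lemma IsGammaSequence.ae_exists_isGapMin (hη : IsGammaSequence P η) (k : ℕ) :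
    ∀ᵐ ω ∂P, ∃ i₀ κ, 1 < κ ∧ IsGapMin κ (fun j : {j // k + 1 ≤ j} => limitRatio η j ω) i₀ := by
  have hne : ∀ᵐ ω ∂P, ∀ i j, 1 ≤ i → i < j → limitRatio η i ω ≠ limitRatio η j ω := by
    simpa only [ae_all_iff, eventually_imp_distrib_left] using fun i j hi hij =>
      hη.ae_limitRatio_ne hi hij
  filter_upwards [hη.ae_pos, hη.ae_tendsto_div, hne] with ω hpos hlim hne
  refine exists_isGapMin (c := 1)
    (fun j => div_pos (hpos _ (by have := j.2; omega)) (hpos _ (by omega))) ?_ ?_ ?_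
  · exact fun i j h => Subtype.ext <| by
      by_contra hij
      obtain hlt | hlt := lt_or_gt_of_ne hij
      · exact hne i j (by have := i.2; omega) hlt h
      · exact hne j i (by have := j.2; omega) hlt h.symm
  · have h := tendsto_limitRatio hlim
    rw [← Nat.cofinite_eq_atTop] at h
    exact h.comp Subtype.val_injective.tendsto_cofinite
  · obtain ⟨j, hj, hlt⟩ := exists_limitRatio_lt_one hpos hlim (k + 1)
    exact ⟨⟨j, hj⟩, hlt⟩

end LimitSequence

section ReductionLevel

lemma MulClose.abs_sub_le {κ x y : ℝ} (h : MulClose κ x y) (hκ : 1 < κ) :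
    |x - y| ≤ (κ - 1) * y := by
  obtain ⟨hyx, hxy⟩ := h
  have : 0 ≤ y := by
    refine (mul_nonneg_iff_of_pos_left (sub_pos.2 (one_lt_pow₀ hκ two_ne_zero))).1 ?_
    linarith [mul_le_mul_of_nonneg_left hxy (zero_lt_one.trans hκ).le]
  exact abs_sub_le_iff.2 ⟨by linarith, by nlinarith⟩

lemma tendsto_measure_le_dist_of_tendstoInDistribution_const {ι E Ω' : Type*} {l : Filter ι}
    {Ω : ι → Type*} [∀ i, MeasurableSpace (Ω i)] {P : ∀ i, Measure (Ω i)}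
    [∀ i, IsProbabilityMeasure (P i)] [MeasurableSpace Ω'] {P' : Measure Ω'}
    [IsProbabilityMeasure P'] [PseudoMetricSpace E] [MeasurableSpace E] [BorelSpace E]
    {X : ∀ i, Ω i → E} {c : E} (h : TendstoInDistribution X l (fun _ => c) P P') {ε : ℝ}
    (hε : 0 < ε) : Tendsto (fun i => P i {ω | ε ≤ dist (X i ω) c}) l (𝓝 0) := by
  have hclosed : IsClosed {x : E | ε ≤ dist x c} :=
    isClosed_le continuous_const (continuous_id.dist continuous_const)
  have hlimsup := ProbabilityMeasure.limsup_measure_closed_le_of_tendsto h.tendsto hclosed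
  simp only [ProbabilityMeasure.coe_mk,
    Measure.map_apply_of_aemeasurable (h.forall_aemeasurable _) hclosed.measurableSet,
    Measure.map_apply measurable_const hclosed.measurableSet, Set.preimage_ofPred_eq, dist_self,
    hε.not_ge, Set.ofPred_false, measure_empty] at hlimsup
  exact tendsto_of_le_liminf_of_limsup_le bot_le hlimsup

variable {Ω' : Type*} {η : ℕ → Ω' → ℝ} {ω : Ω'}

lemma IsGapMin.limitVector {n k : ℕ} {κ : ℝ} {i₀ : {j // k + 1 ≤ j}}
    (h : IsGapMin κ (fun j : {j // k + 1 ≤ j} => limitRatio η j ω) i₀) (hn : i₀ < n) :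
    IsGapMin κ (limitVector η n (n - k) ω) ⟨n - 1 - i₀, by have := i₀.2; omega⟩ := by
  let e (i : Fin (n - k - 1)) : {j // k + 1 ≤ j} := ⟨n - 1 - i, by omega⟩
  have he : Function.Injective e := fun i j hij =>
    Fin.ext (by have := Subtype.mk.inj hij; omega)
  have hei : e ⟨n - 1 - i₀, by have := i₀.2; omega⟩ = i₀ :=
    Subtype.ext (by simp only [e]; omega)
  exact IsGapMin.comp_injective he (hei ▸ h)

lemma tendsto_iInf_limitVector {c : ℝ} {g : ℕ → ℕ}
    (h : Tendsto (fun j => limitRatio η j ω) atTop (𝓝 c)) (hg : ∀ᶠ n in atTop, g n + 2 ≤ n)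
    (hg_top : Tendsto g atTop atTop) :
    Tendsto (fun n => ⨅ i, limitVector η n (n - g n) ω i) atTop (𝓝 c) := by
  refine tendsto_def.2 fun s hs => ?_
  obtain ⟨N, hN⟩ := eventually_atTop.1 (h.eventually_mem hs)
  filter_upwards [hg, hg_top.eventually_ge_atTop N] with n hn hgN
  have : Nonempty (Fin (n - g n - 1)) := ⟨⟨0, by omega⟩⟩
  obtain ⟨i, hi⟩ := exists_eq_ciInf_of_finite (f := limitVector η n (n - g n) ω)
  rw [Set.mem_preimage, ← hi]
  exact hN _ (by omega)

variable [MeasurableSpace Ω'] {P' : Measure Ω'} [IsProbabilityMeasure P']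
  {ν : ∀ n : ℕ, Measure (EuclideanSpace ℝ (Fin n))} {Ω : ℕ → Type*} [∀ n, MeasurableSpace (Ω n)]
  {P : ∀ n, Measure (Ω n)} [∀ n, IsProbabilityMeasure (P n)]

lemma tendstoInDistribution_reductionLevel_of_ae_tendsto
    (hν : ∀ᶠ n in atTop, IsRotationInvariant (ν n)) (hconc : WeakRadialConcentration ν)
    (hη : IsGammaSequence P' η) {p : ℕ → ℕ} (hp : ∀ n, p n ≤ n) (hp0 : ∀ᶠ n in atTop, 0 < p n)
    {b : ∀ n : ℕ, Fin (p n) → Ω n → EuclideanSpace ℝ (Fin n)}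
    (hb : ∀ n, IsRandomBasis (P n) (ν n) (b n)) {Z : Ω' → ℝ}
    (hZ : ∀ᵐ ω ∂P', Tendsto (fun n => ⨅ i, limitVector η n (p n) ω i) atTop (𝓝 (Z ω))) :
    TendstoInDistribution (fun n ω => reductionLevel fun i => b n i ω) atTop Z P P' := by
  have hmeas (n : ℕ) : Measurable fun r : Fin (p n - 1) → ℝ => ⨅ i, r i :=
    .iInf fun i => measurable_pi_apply i
  refine tendstoInDistribution_comp_localRatio hν hconc hη hp hp0 hb hmeas hZ
    fun κ hκ hκ1 ε hε => ⟨fun n => {y | (κ n - 1) * ⨅ i, y i < ε},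
      fun n => measurableSet_lt ((hmeas n).const_mul _) measurable_const, ?_,
      .of_forall fun n x y hy hxy => ?_⟩
  · filter_upwards [hZ] with ω hω
    have hlim := (hκ1.sub_const 1).mul hω
    rw [sub_self, zero_mul] at hlim
    exact hlim.eventually_lt_const hε
  · exact ((MulClose.iInf (by linarith [hκ n]) hxy).abs_sub_le (hκ n)).trans_lt hy

theorem tendstoInDistribution_reductionLevel
    (hν : ∀ᶠ n in atTop, IsRotationInvariant (ν n)) (hconc : WeakRadialConcentration ν)
    (hη : IsGammaSequence P' η) {k : ℕ} {b : ∀ n : ℕ, Fin (n - k) → Ω n → EuclideanSpace ℝ (Fin n)}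
    (hb : ∀ n, IsRandomBasis (P n) (ν n) (b n)) :
    TendstoInDistribution (fun n ω => reductionLevel fun i => b n i ω) atTop
      (limitLevel η k) P P' := by
  refine tendstoInDistribution_reductionLevel_of_ae_tendsto hν hconc hη (fun n => n.sub_le k)
    ((eventually_gt_atTop k).mono fun n hn => Nat.sub_pos_of_lt hn) hb ?_
  filter_upwards [hη.ae_exists_isGapMin k] with ω ⟨i₀, κ, hκ, h⟩
  refine tendsto_const_nhds.congr' ?_
  filter_upwards [eventually_gt_atTop (i₀ : ℕ)] with n hn
  rw [limitLevel, h.iInf_eq hκ, (h.limitVector hn).iInf_eq hκ, limitVector]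
  exact congrArg (limitRatio η · ω) (by simp only; omega)

theorem tendsto_measure_le_abs_reductionLevel_sub_one
    (hν : ∀ᶠ n in atTop, IsRotationInvariant (ν n)) (hconc : WeakRadialConcentration ν)
    (hη : IsGammaSequence P' η) {g : ℕ → ℕ} (hg : ∀ᶠ n in atTop, g n + 2 ≤ n)
    (hg_top : Tendsto g atTop atTop) {b : ∀ n : ℕ, Fin (n - g n) → Ω n → EuclideanSpace ℝ (Fin n)}
    (hb : ∀ n, IsRandomBasis (P n) (ν n) (b n)) {ε : ℝ} (hε : 0 < ε) :
    Tendsto (fun n => P n {ω | ε ≤ |reductionLevel (fun i => b n i ω) - 1|}) atTop (𝓝 0) :=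
  tendsto_measure_le_dist_of_tendstoInDistribution_const
    (tendstoInDistribution_reductionLevel_of_ae_tendsto hν hconc hη (fun n => n.sub_le (g n))
      (hg.mono fun n hn => by omega) hb <| hη.ae_tendsto_div.mono fun ω hω =>
        tendsto_iInf_limitVector (tendsto_limitRatio hω) hg hg_top) hε

end ReductionLevel

section WorstIndex

/-- The index of worst local reduction, in the numbering of `worstIndex`, of a system in `ℝⁿ` with
local ratios `r`. -/
noncomputable def minIndex (n : ℕ) {m : ℕ} (r : Fin m → ℝ) : ℕ :=
  sInf {j : ℕ | ∃ i : Fin m, j + ((i : ℕ) + 1) = n ∧ r i = ⨅ i, r i}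

lemma IsGapMin.minIndex_eq {n m j : ℕ} {κ : ℝ} {r : Fin m → ℝ} {i₀ : Fin m}
    (h : IsGapMin κ r i₀) (hκ : 1 < κ) (hj : j + (i₀ + 1) = n) : minIndex n r = j := by
  simp only [minIndex, h.eq_iInf_iff hκ, exists_eq_right, ← hj, add_left_inj,
    Set.ofPred_eq_eq_singleton, csInf_singleton]

lemma measurable_sInf_nat {α : Type*} [MeasurableSpace α] {s : α → Set ℕ}
    (hs : ∀ j, MeasurableSet {a | j ∈ s a}) : Measurable fun a => sInf (s a) := by
  classical
  have hex (a : α) : ∃ j, j ∈ s a ∨ s a = ∅ := by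
    obtain h | ⟨j, hj⟩ := (s a).eq_empty_or_nonempty
    · exact ⟨0, .inr h⟩
    · exact ⟨j, .inl hj⟩
  have hfind (a : α) : sInf (s a) = Nat.find (hex a) := by
    obtain h | h := (s a).eq_empty_or_nonempty
    · rw [(Nat.find_eq_zero (hex a)).2 (Or.inr h), h, Nat.sInf_empty]
    · simp [h.ne_empty, Nat.sInf_def h]
  have hempty : MeasurableSet {a | s a = ∅} := by
    simp only [Set.eq_empty_iff_forall_notMem, Set.ofPred_forall]
    exact .iInter fun j => (hs j).compl
  simp only [hfind]
  exact measurable_find hex fun j => (hs j).union hempty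

lemma measurable_minIndex (n m : ℕ) : Measurable (minIndex n : (Fin m → ℝ) → ℕ) := by
  have hmin : Measurable fun r : Fin m → ℝ => ⨅ i, r i := .iInf fun i => measurable_pi_apply i
  refine measurable_sInf_nat fun j => ?_
  simp only [Set.mem_ofPred_eq]
  simp only [Set.ofPred_exists, Set.ofPred_and]
  exact .iUnion fun i => (MeasurableSet.const _).inter
    (measurableSet_eq_fun (measurable_pi_apply i) hmin)

variable {Ω' : Type*} {η : ℕ → Ω' → ℝ} {ω : Ω'}

lemma IsGapMin.eq_limitLevel_iff {k : ℕ} {κ : ℝ} {i₀ : {j // k + 1 ≤ j}}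
    (h : IsGapMin κ (fun j : {j // k + 1 ≤ j} => limitRatio η j ω) i₀) (hκ : 1 < κ) {j : ℕ} :
    k + 1 ≤ j ∧ limitRatio η j ω = limitLevel η k ω ↔ j = i₀ := by
  constructor
  · exact fun ⟨hj, he⟩ => congrArg Subtype.val ((h.eq_iInf_iff (i := ⟨j, hj⟩) hκ).1 he)
  · rintro rfl
    exact ⟨i₀.2, (h.eq_iInf_iff hκ).2 rfl⟩

lemma IsGapMin.limitIndex_eq {k : ℕ} {κ : ℝ} {i₀ : {j // k + 1 ≤ j}}
    (h : IsGapMin κ (fun j : {j // k + 1 ≤ j} => limitRatio η j ω) i₀) (hκ : 1 < κ) :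
    limitIndex η k ω = i₀ := by
  simp only [limitIndex, h.eq_limitLevel_iff hκ, Set.ofPred_eq_eq_singleton, csInf_singleton]

variable [MeasurableSpace Ω'] {P' : Measure Ω'} [IsProbabilityMeasure P']

lemma IsGammaSequence.ae_existsUnique_eq_limitLevel (hη : IsGammaSequence P' η) (k : ℕ) :
    ∀ᵐ ω ∂P', ∃! j, k + 1 ≤ j ∧ limitRatio η j ω = limitLevel η k ω := by
  filter_upwards [hη.ae_exists_isGapMin k] with ω ⟨i₀, κ, hκ, h⟩
  simp only [h.eq_limitLevel_iff hκ, existsUnique_eq]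

theorem tendstoInDistribution_worstIndex {ν : ∀ n : ℕ, Measure (EuclideanSpace ℝ (Fin n))}
    (hν : ∀ᶠ n in atTop, IsRotationInvariant (ν n)) (hconc : WeakRadialConcentration ν)
    (hη : IsGammaSequence P' η) {Ω : ℕ → Type*} [∀ n, MeasurableSpace (Ω n)]
    {P : ∀ n, Measure (Ω n)} [∀ n, IsProbabilityMeasure (P n)] {k : ℕ}
    {b : ∀ n : ℕ, Fin (n - k) → Ω n → EuclideanSpace ℝ (Fin n)}
    (hb : ∀ n, IsRandomBasis (P n) (ν n) (b n)) :
    TendstoInDistribution (fun n ω => worstIndex fun i => b n i ω) atTop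
      (limitIndex η k) P P' := by
  refine tendstoInDistribution_comp_localRatio hν hconc hη (fun n => n.sub_le k)
    ((eventually_gt_atTop k).mono fun n hn => Nat.sub_pos_of_lt hn) hb
    (fun n => measurable_minIndex n _) ?_ fun κ hκ hκ1 ε hε =>
      ⟨fun n => {y | ∃ i₀, IsGapMin (κ n ^ 3) y i₀},
        fun n => measurableSet_exists_isGapMin _ _, ?_, .of_forall ?_⟩
  · filter_upwards [hη.ae_exists_isGapMin k] with ω ⟨i₀, κ, hκ, h⟩
    refine tendsto_const_nhds.congr' ?_
    filter_upwards [eventually_gt_atTop (i₀ : ℕ)] with n hn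
    rw [h.limitIndex_eq hκ, (h.limitVector hn).minIndex_eq hκ]
    simp only; omega
  · filter_upwards [hη.ae_exists_isGapMin k] with ω ⟨i₀, κ', hκ', h⟩
    have hlim : Tendsto (fun n => κ n ^ 3) atTop (𝓝 1) := by
      simpa only [one_pow] using hκ1.pow 3
    filter_upwards [eventually_gt_atTop (i₀ : ℕ), hlim.eventually_lt_const hκ'] with n hn hlt
    exact ⟨_, (h.limitVector hn).mono hlt.le⟩
  · rintro n x y ⟨i₀, hy⟩ hxy
    have hj : n - 1 - i₀ + (i₀ + 1) = n := by omega
    rwa [(hy.of_mulClose (zero_lt_one.trans (hκ n)) hxy).minIndex_eq (hκ n) hj,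
      hy.minIndex_eq (one_lt_pow₀ (hκ n) three_ne_zero) hj, dist_self]

end WorstIndex

end RandomBasis

theorem theorem1p8_general
    (ν : ∀ n : ℕ, Measure (EuclideanSpace ℝ (Fin n)))
    (hν : ∀ᶠ n in atTop, RandomBasis.IsRotationInvariant (ν n))
    (hconc : RandomBasis.WeakRadialConcentration ν)
    {Ω : ℕ → Type*} [∀ n, MeasurableSpace (Ω n)]
    (P : ∀ n, Measure (Ω n)) [∀ n, IsProbabilityMeasure (P n)]
    {Ω' : Type*} [MeasurableSpace Ω'] (P' : Measure Ω') [IsProbabilityMeasure P']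
    (η : ℕ → Ω' → ℝ) (hη : RandomBasis.IsGammaSequence P' η) :
    (∀ (k : ℕ) (b : ∀ n : ℕ, Fin (n - k) → Ω n → EuclideanSpace ℝ (Fin n)),
      (∀ n, RandomBasis.IsRandomBasis (P n) (ν n) (b n)) →
      TendstoInDistribution (fun n ω => RandomBasis.reductionLevel (fun i => b n i ω)) atTop
        (RandomBasis.limitLevel η k) P P') ∧
    (∀ (g : ℕ → ℕ) (b : ∀ n : ℕ, Fin (n - g n) → Ω n → EuclideanSpace ℝ (Fin n)),
      (∀ᶠ n in atTop, g n + 2 ≤ n) → Tendsto g atTop atTop →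
      (∀ n, RandomBasis.IsRandomBasis (P n) (ν n) (b n)) →
      ∀ ε : ℝ, 0 < ε →
        Tendsto (fun n => P n {ω | ε ≤ |RandomBasis.reductionLevel (fun i => b n i ω) - 1|})
          atTop (𝓝 0)) ∧
    (∀ k : ℕ,
      (∀ᵐ ω ∂P', ∃! j : ℕ,
        k + 1 ≤ j ∧ RandomBasis.limitRatio η j ω = RandomBasis.limitLevel η k ω) ∧
      ∀ b : ∀ n : ℕ, Fin (n - k) → Ω n → EuclideanSpace ℝ (Fin n),
        (∀ n, RandomBasis.IsRandomBasis (P n) (ν n) (b n)) →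
        TendstoInDistribution (fun n ω => RandomBasis.worstIndex (fun i => b n i ω)) atTop
          (RandomBasis.limitIndex η k) P P') :=
  ⟨fun _ _ hb => RandomBasis.tendstoInDistribution_reductionLevel hν hconc hη hb,
    fun _ _ hg hg_top hb _ hε =>
      RandomBasis.tendsto_measure_le_abs_reductionLevel_sub_one hν hconc hη hg hg_top hb hε,
    fun k => ⟨hη.ae_existsUnique_eq_limitLevel k,
      fun _ hb => RandomBasis.tendstoInDistribution_worstIndex hν hconc hη hb⟩⟩

theorem theorem1p8
    (ν : ∀ n : ℕ, Measure (EuclideanSpace ℝ (Fin n)))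
    (hν : RandomBasis.IsSpherical ν) (hconc : RandomBasis.RadialConcentration ν)
    {Ω : ℕ → Type*} [∀ n, MeasurableSpace (Ω n)]
    (P : ∀ n, Measure (Ω n)) [∀ n, IsProbabilityMeasure (P n)]
    {Ω' : Type*} [MeasurableSpace Ω'] (P' : Measure Ω') [IsProbabilityMeasure P']
    (η : ℕ → Ω' → ℝ) (hη : RandomBasis.IsGammaSequence P' η) :
    (∀ (k : ℕ) (b : ∀ n : ℕ, Fin (n - k) → Ω n → EuclideanSpace ℝ (Fin n)),
      (∀ n, RandomBasis.IsRandomBasis (P n) (ν n) (b n)) →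
      TendstoInDistribution (fun n ω => RandomBasis.reductionLevel (fun i => b n i ω)) atTop
        (RandomBasis.limitLevel η k) P P') ∧
    (∀ (g : ℕ → ℕ) (b : ∀ n : ℕ, Fin (n - g n) → Ω n → EuclideanSpace ℝ (Fin n)),
      (∀ᶠ n in atTop, g n + 2 ≤ n) → Tendsto g atTop atTop →
      (∀ n, RandomBasis.IsRandomBasis (P n) (ν n) (b n)) →
      ∀ ε : ℝ, 0 < ε →
        Tendsto (fun n => P n {ω | ε ≤ |RandomBasis.reductionLevel (fun i => b n i ω) - 1|})
          atTop (𝓝 0)) ∧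
    (∀ k : ℕ,
      (∀ᵐ ω ∂P', ∃! j : ℕ,
        k + 1 ≤ j ∧ RandomBasis.limitRatio η j ω = RandomBasis.limitLevel η k ω) ∧
      ∀ b : ∀ n : ℕ, Fin (n - k) → Ω n → EuclideanSpace ℝ (Fin n),
        (∀ n, RandomBasis.IsRandomBasis (P n) (ν n) (b n)) →
        TendstoInDistribution (fun n ω => RandomBasis.worstIndex (fun i => b n i ω)) atTop
          (RandomBasis.limitIndex η k) P P') :=
  theorem1p8_general ν ((eventually_ge_atTop 1).mono fun n hn => (hν n hn).map_isometry)
    (hconc.weak ((eventually_ge_atTop 1).mono fun n hn => (hν n hn).isProbabilityMeasure)) P P' η hη
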